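/- Let $0<\alpha<1$, let $\lambda\in\mathbb{C}\setminus\{0\}$ satisfy $|\arg\lambda|<\alpha\pi/2$ (that is, $\lambda\in\Lambda^u_\alpha$; $\arg$ takes values in $(-\pi,\pi]$, and powers of $\lambda$ are principal), and let $f:[0,\infty)\to\mathbb{R}$ be bounded and continuous. A solution of the scalar Caputo equation $${}^{C}\!D^{\alpha}_{0+}x(t)=\lambda x(t)+f(t),\qquad t>0,$$ is a continuous function $x:[0,\infty)\to\mathbb{C}$ such that for every $t>0$ the Caputo derivative $${}^{C}\!D^{\alpha}_{0+}x(t):=\frac{d}{dt}\,\frac{1}{\Gamma(1-\alpha)}\int_0^t (t-\tau)^{-\alpha}\bigl(x(\tau)-x(0)\bigr)\,d\tau$$ exists and equals $\lambda x(t)+f(t)$. For $\beta>0$ and $z\in\mathbb{C}$ let $E_{\alpha,\beta}(z)=\sum_{k=0}^\infty z^k/\Gamma(\alpha k+\beta)$ and $E_\alpha=E_{\alpha,1}$. Then, among all solutions (with arbitrary initial value $x(0)\in\mathbb{C}$), there is exactly one that is bounded on $[0,\infty)$. It is given by $$\varphi(t)=E_\alpha(\lambda t^\alpha)\,\bar x_0+\int_0^t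 (t-\tau)^{\alpha-1}E_{\alpha,\alpha}\bigl(\lambda(t-\tau)^\alpha\bigr)f(\tau)\,d\tau,\qquad t\ge 0,$$ with initial value $$\varphi(0)=\bar x_0=-\lambda^{\frac1\alpha-1}\int_0^\infty \exp\bigl(-\lambda^{\frac1\alpha}\tau\bigr)f(\tau)\,d\tau ,$$ where both integrals converge absolutely. If, in addition, $f(t)\to0$ as $t\to\infty$, then $\varphi(t)\to0$ as $t\to\infty$. -/

import Mathlib

open Set Filter Topology MeasureTheory

noncomputable section

/-- The unstable sector: nonzero complex numbers with `|arg| < α π / 2`, where `arg` takes its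
values in `(-π, π]`. -/
def unstableSector (α : ℝ) : Set ℂ :=
  {z : ℂ | z ≠ 0 ∧ |Complex.arg z| < α * Real.pi / 2}

/-- The two-parameter Mittag-Leffler function `E_{α,β}(z) = ∑ z ^ k / Γ(α k + β)`. -/
def mittagLeffler (α β : ℝ) (z : ℂ) : ℂ :=
  ∑' k : ℕ, z ^ k / ((Real.Gamma (α * k + β) : ℝ) : ℂ)

/-- The Riemann-Liouville integral of order `β` with base point `0`, for functions on `[0, ∞)`
(values of `x` at negative arguments play no role when `0 ≤ t`). -/
def rlIntegral (β : ℝ) (x : ℝ → ℂ) (t : ℝ) : ℂ :=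
  ((1 / Real.Gamma β : ℝ) : ℂ) * ∫ τ in (0 : ℝ)..t, (((t - τ) ^ (β - 1) : ℝ) : ℂ) * x τ

/-- `x` has at `t > 0` the Caputo derivative `y` of order `α ∈ (0, 1)` with base point `0`, that is,
the Riemann-Liouville derivative `d/dt I^{1-α}` of `x - x(0)` exists at `t` and equals `y`.
For continuously differentiable `x` this value is `(I^{1-α} x')(t)`; the present form also makes
sense for functions that are merely continuous, as solutions of fractional equations are. -/
def HasCaputoDerivAt (α : ℝ) (x : ℝ → ℂ) (y : ℂ) (t : ℝ) : Prop :=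
  HasDerivAt (rlIntegral (1 - α) (fun τ => x τ - x 0)) y t

/-- `x` is a solution on `[0, ∞)` of the scalar equation `D^α x = lam x + f`: it is continuous on
`[0, ∞)`, and at every `t > 0` its Caputo derivative exists and satisfies the equation. -/
def IsCaputoSolution (α : ℝ) (lam : ℂ) (f : ℝ → ℝ) (x : ℝ → ℂ) : Prop :=
  ContinuousOn x (Ici 0) ∧
    ∀ t : ℝ, 0 < t → HasCaputoDerivAt α x (lam * x t + ((f t : ℝ) : ℂ)) t

/-- `x` is bounded on `[0, ∞)`. -/
def BoundedOnHalfLine {E : Type*} [Norm E] (x : ℝ → E) : Prop :=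
  ∃ C : ℝ, ∀ t : ℝ, 0 ≤ t → ‖x t‖ ≤ C

/-- The integrand `τ ↦ exp(-lam^{1/α} τ) f(τ)`, with the principal branch of the power. -/
def laplaceIntegrand (α : ℝ) (lam : ℂ) (f : ℝ → ℝ) (τ : ℝ) : ℂ :=
  Complex.exp (-(lam ^ ((1 / α : ℝ) : ℂ)) * (τ : ℂ)) * ((f τ : ℝ) : ℂ)

/-- The initial value `-lam^{1/α-1} ∫_0^∞ exp(-lam^{1/α} τ) f(τ) dτ`. -/
def boundedInitialValue (α : ℝ) (lam : ℂ) (f : ℝ → ℝ) : ℂ :=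
  -(lam ^ ((1 / α - 1 : ℝ) : ℂ)) * ∫ τ in Ioi (0 : ℝ), laplaceIntegrand α lam f τ

/-- The integrand `τ ↦ (t-τ)^{α-1} E_{α,α}(lam (t-τ)^α) f(τ)`. -/
def convolutionIntegrand (α : ℝ) (lam : ℂ) (f : ℝ → ℝ) (t τ : ℝ) : ℂ :=
  (((t - τ) ^ (α - 1) : ℝ) : ℂ) * mittagLeffler α α (lam * (((t - τ) ^ α : ℝ) : ℂ)) *
    ((f τ : ℝ) : ℂ)

/-- The function
`t ↦ E_α(lam t^α) x₀ + ∫_0^t (t-τ)^{α-1} E_{α,α}(lam (t-τ)^α) f(τ) dτ`. -/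
def variationOfConstants (α : ℝ) (lam : ℂ) (f : ℝ → ℝ) (x₀ : ℂ) (t : ℝ) : ℂ :=
  mittagLeffler α 1 (lam * ((t ^ α : ℝ) : ℂ)) * x₀ +
    ∫ τ in (0 : ℝ)..t, convolutionIntegrand α lam f t τ

end

/-! The proof is by Laplace transform. Put `w₀ = log λ / α` and `μ = exp w₀ = λ^(1/α)`. The sector
condition says `|Im w₀| < π/2`, so `Re μ > 0` and `μ^α = λ`.

Uniqueness. If `X` and `F` are the transforms of a bounded solution and of `f`, then `(s^α - λ) X(s)
= s^(α-1) x(0) + F(s)` for all `Re s > 0` (`laplace_equation_of_isCaputoSolution`). At `s = μ` the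
left side vanishes, which forces `x(0) = -μ^(1-α) F(μ)`, the stated value. The equation then
determines `X` on a vertical line far to the right, and injectivity of the transform
(`HasLaplace.eq_of_line`) determines `x`.

Existence. The same injectivity shows that the variation of constants formula satisfies the
integrated equation `I^(1-α)(x - x(0)) = ∫ (λ x + f)`; differentiating gives the Caputo equation.

Boundedness and decay. On the plane cut along the negative axis, `1/(s^α - λ)` has the single pole
`μ`, with residue `μ^(1-α)/α`. Without its principal part it is a Stieltjes integral of its jump
across the cut (`integral_cutJump_mul`), so its inverse transform is a superposition of decaying
exponentials. Hence `t^(α-1) E_{α,α}(λ t^α)` is `(μ^(1-α)/α) e^(μt)` plus a function integrable on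
the half-line, and `E_α(λ t^α)` is `(1/α) e^(μt)` plus a bounded function tending to `0`. For the
distinguished initial value the growing terms combine into the tail integral `-(μ^(1-α)/α) ∫_0^∞
e^(-μτ) f(τ + t) dτ` (`variationOfConstants_eq_remainders`), and each remaining term is bounded and
inherits decay from `f`. -/

noncomputable section

/-! ### Absolutely convergent Laplace integrals and injectivity of the transform. -/

/-- The Laplace integral of `u` at `s` converges absolutely and has the value `X`. -/
structure HasLaplace (u : ℝ → ℂ) (s X : ℂ) : Prop where
  integrableOn : IntegrableOn (fun t : ℝ => Complex.exp (-(s * t)) * u t) (Ioi 0)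
  integral_eq : ∫ t in Ioi (0 : ℝ), Complex.exp (-(s * t)) * u t = X

/-- The convolution of two functions on the half-line. -/
def halfConv (u v : ℝ → ℂ) (t : ℝ) : ℂ := ∫ τ in (0 : ℝ)..t, u (t - τ) * v τ

namespace HasLaplace

variable {u v : ℝ → ℂ} {s X Y : ℂ}

theorem add (hu : HasLaplace u s X) (hv : HasLaplace v s Y) :
    HasLaplace (fun t => u t + v t) s (X + Y) where
  integrableOn := by
    simp only [mul_add]
    exact Integrable.add hu.1 hv.1
  integral_eq := by
    simp only [mul_add]
    rw [integral_add hu.1 hv.1, hu.2, hv.2]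

theorem const_mul (c : ℂ) (hu : HasLaplace u s X) : HasLaplace (fun t => c * u t) s (c * X) where
  integrableOn := by
    simp only [mul_left_comm _ c]
    exact Integrable.const_mul hu.1 c
  integral_eq := by
    simp only [mul_left_comm _ c]
    rw [integral_const_mul, hu.2]

theorem mul_const (c : ℂ) (hu : HasLaplace u s X) : HasLaplace (fun t => u t * c) s (X * c) := by
  simpa only [mul_comm _ c] using hu.const_mul c

theorem sub (hu : HasLaplace u s X) (hv : HasLaplace v s Y) :
    HasLaplace (fun t => u t - v t) s (X - Y) := by
  simpa [sub_eq_add_neg] using hu.add (hv.const_mul (-1))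

theorem congr (hu : HasLaplace u s X) (h : ∀ t, 0 < t → u t = v t) : HasLaplace v s X where
  integrableOn := hu.1.congr_fun (fun t ht => by simp only [h t ht]) measurableSet_Ioi
  integral_eq := by
    rw [← hu.2]
    exact setIntegral_congr_fun measurableSet_Ioi (fun t ht => by simp only [h t ht])

theorem congr_value (hu : HasLaplace u s X) (h : X = Y) : HasLaplace u s Y := h ▸ hu

theorem unique (hu : HasLaplace u s X) (hv : HasLaplace u s Y) : X = Y := by
  rw [← hu.2, ← hv.2]

/-- Since `e^(-sx) = e^(-st) e^(-s(x-t))`, the weight distributes over the convolution, and the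
claim becomes Fubini for the integrable weighted functions. -/
theorem conv (hu : HasLaplace u s X) (hv : HasLaplace v s Y) :
    HasLaplace (halfConv u v) s (X * Y) := by
  have key : ∀ x : ℝ, ∫ t in (0 : ℝ)..x, ContinuousLinearMap.mul ℝ ℂ
      (Complex.exp (-(s * t)) * v t)
      (Complex.exp (-(s * (x - t : ℝ))) * u (x - t)) =
      Complex.exp (-(s * x)) * halfConv u v x := by
    intro x
    rw [halfConv, ← intervalIntegral.integral_const_mul]
    refine intervalIntegral.integral_congr fun t _ => ?_
    have : Complex.exp (-(s * x)) =
        Complex.exp (-(s * t)) * Complex.exp (-(s * (x - t : ℝ))) := by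
      rw [← Complex.exp_add]; congr 1; push_cast; ring
    simp only [ContinuousLinearMap.mul_apply', this]
    ring
  constructor
  · have := integrable_posConvolution hv.1 hu.1 (ContinuousLinearMap.mul ℝ ℂ)
    simp only [posConvolution, key] at this
    rwa [integrable_indicator_iff measurableSet_Ioi] at this
  · have := integral_posConvolution hv.1 hu.1 (ContinuousLinearMap.mul ℝ ℂ)
    simp only [key] at this
    rw [this, hv.2, hu.2, ContinuousLinearMap.mul_apply', mul_comm]

theorem integrableOn_Ioc (hu : HasLaplace u s X) (T : ℝ) : IntegrableOn u (Ioc 0 T) := by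
  have : u = fun t : ℝ => (Complex.exp (-(s * t)) * u t) * Complex.exp (s * t) := by
    ext t
    rw [mul_right_comm, ← Complex.exp_add]
    simp
  rw [this]
  have h1 : IntegrableOn (fun t : ℝ => Complex.exp (-(s * t)) * u t) (Icc 0 T) :=
    (integrableOn_Icc_iff_integrableOn_Ioc).2 (hu.1.mono_set Ioc_subset_Ioi_self)
  have h2 : ContinuousOn (fun t : ℝ => Complex.exp (s * t)) (Icc 0 T) := by fun_prop
  exact (h1.mul_continuousOn h2 isCompact_Icc).mono_set Ioc_subset_Icc_self

theorem exp {m : ℂ} (h : m.re < s.re) :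
    HasLaplace (fun t : ℝ => Complex.exp (m * t)) s (1 / (s - m)) := by
  have e : (fun t : ℝ => Complex.exp (-(s * t)) * Complex.exp (m * t)) =
      fun t : ℝ => Complex.exp ((m - s) * t) := by
    ext t; rw [← Complex.exp_add]; congr 1; ring
  have hre : (m - s).re < 0 := by simpa using h
  constructor
  · rw [e]; exact integrableOn_exp_mul_complex_Ioi hre 0
  · rw [e, integral_exp_mul_complex_Ioi hre 0, ← neg_sub s m, neg_div_neg_eq]
    simp

theorem const (c : ℂ) (hs : 0 < s.re) : HasLaplace (fun _ => c) s (c / s) := by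
  have := (HasLaplace.exp (m := 0) (s := s) (by simpa using hs)).const_mul c
  simpa [div_eq_mul_inv] using this

theorem of_bounded (hs : 0 < s.re) (hu : ContinuousOn u (Ici 0)) (hb : BoundedOnHalfLine u) :
    HasLaplace u s (∫ t in Ioi (0 : ℝ), Complex.exp (-(s * t)) * u t) := by
  refine ⟨?_, rfl⟩
  obtain ⟨C, hC⟩ := hb
  have h1 : IntegrableOn (fun t : ℝ => Complex.exp ((-s) * t)) (Ioi 0) :=
    integrableOn_exp_mul_complex_Ioi (by simpa using hs) 0
  simp only [neg_mul] at h1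
  refine Integrable.mul_bdd (c := C) h1
    ((hu.mono Ioi_subset_Ici_self).aestronglyMeasurable measurableSet_Ioi) ?_
  filter_upwards [ae_restrict_mem measurableSet_Ioi] with t ht using hC t (le_of_lt ht)

/-- Two functions with the same Laplace transform on a vertical line agree at every positive point
of continuity. -/
theorem eq_of_line {σ : ℝ} {F : ℂ → ℂ} (hu : ∀ s : ℂ, s.re = σ → HasLaplace u s (F s))
    (hv : ∀ s : ℂ, s.re = σ → HasLaplace v s (F s)) {t : ℝ} (ht : 0 < t)
    (cu : ContinuousAt u t) (cv : ContinuousAt v t) : u t = v t := by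
  -- The Fourier transform of `d` at `w` is the Laplace transform of `u - v` at `σ + 2πiw`, hence
  -- zero; pointwise Fourier inversion at a continuity point finishes.
  set d : ℝ → ℂ := (Ioi (0 : ℝ)).indicator
    (fun t : ℝ => Complex.exp (-((σ : ℂ) * t)) * (u t - v t)) with hd
  have hd' : ∀ s : ℂ, s.re = σ → HasLaplace (fun t => u t - v t) s 0 := fun s hs =>
    ((hu s hs).sub (hv s hs)).congr_value (sub_self _)
  have hint : Integrable d :=
    (integrable_indicator_iff measurableSet_Ioi).2 (hd' σ (by simp)).1
  have hF : FourierTransform.fourier d = fun _ => (0 : ℂ) := by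
    ext w
    rw [Real.fourier_real_eq_integral_exp_smul]
    have h := (hd' (σ + 2 * Real.pi * w * Complex.I) (by simp)).2
    rw [← integral_indicator measurableSet_Ioi] at h
    rw [← h]
    congr 1
    ext t
    simp only [hd, indicator]
    split_ifs
    · rw [smul_eq_mul, ← mul_assoc, ← Complex.exp_add]
      congr 2
      push_cast
      ring
    · simp
  have hcont : ContinuousAt d t := by
    have : ContinuousAt (fun t : ℝ => Complex.exp (-((σ : ℂ) * t)) * (u t - v t)) t := by
      fun_prop
    refine this.congr ?_
    filter_upwards [Ioi_mem_nhds ht] with x hx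
    rw [hd, indicator_of_mem hx]
  have hinv := hint.fourierInv_fourier_eq (by rw [hF]; exact integrable_zero _ _ _) hcont
  rw [hF, Real.fourierInv_eq] at hinv
  simp only [smul_zero, integral_zero] at hinv
  rw [hd, indicator_of_mem (show t ∈ Ioi 0 from ht)] at hinv
  have := (mul_eq_zero.1 hinv.symm).resolve_left (Complex.exp_ne_zero _)
  exact sub_eq_zero.1 this

end HasLaplace

/-! ### Continuity of convolutions on the half-line. -/

theorem halfConv_eq (u v : ℝ → ℂ) (t : ℝ) :
    halfConv u v t = ∫ τ in (0 : ℝ)..t, u τ * v (t - τ) := by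
  have := intervalIntegral.integral_comp_sub_left (a := 0) (b := t)
    (fun τ => u τ * v (t - τ)) t
  simpa only [halfConv, sub_sub_cancel, sub_self, sub_zero] using this

/-- The convolution of a locally integrable function with a continuous one is continuous. -/
theorem continuousOn_halfConv {u v : ℝ → ℂ} (hu : ∀ T, IntegrableOn u (Ioc 0 T))
    (hv : ContinuousOn v (Ici 0)) : ContinuousOn (halfConv u v) (Ici 0) := by
  set w : ℝ → ℂ := fun t => v (max 0 t) with hw
  have hwc : Continuous w :=
    hv.comp_continuous (by fun_prop) (fun t => mem_Ici.2 (le_max_left 0 t))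
  set u' : ℝ → ℂ := (Ioi (0 : ℝ)).indicator u with hu'
  have hui : ∀ a T, IntegrableOn u' (Ioc a T) := fun a T => by
    rw [hu', IntegrableOn, integrable_indicator_iff measurableSet_Ioi, IntegrableOn,
      Measure.restrict_restrict measurableSet_Ioi]
    exact (hu T).mono_set (fun x hx => ⟨hx.1, hx.2.2⟩)
  have hcont : ∀ t : ℝ, 0 ≤ t → ContinuousAt (fun t => ∫ τ in (0 : ℝ)..t, u' τ * w (t - τ)) t := by
    intro t ht
    obtain ⟨M, hM⟩ := (isCompact_Icc (a := (0 : ℝ)) (b := t + 2)).exists_bound_of_continuousOn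
      hwc.continuousOn
    have hM0 : ∀ x, x ≤ t + 2 → ‖w x‖ ≤ M := by
      intro x hx
      have := hM (max 0 x) ⟨le_max_left _ _, max_le (by linarith) hx⟩
      simpa [hw] using this
    -- The window `(-1, t + 1)` has both endpoints `0` and `t` in its interior, even for `t = 0`;
    -- this is why `u` is extended by zero and `v` by the constant `v 0`.
    have hui' := hui (-1) (t + 1)
    have key := intervalIntegral.continuousAt_parametric_primitive_of_dominated
      (μ := volume) (F := fun (x : ℝ) τ => u' τ * w (x - τ))
      (fun τ => ‖u' τ‖ * M) (-1) (t + 1) (a₀ := 0) (b₀ := t) (x₀ := t) ?_ ?_ ?_ ?_ ?_ ?_ ?_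
    · exact ContinuousAt.comp (f := fun t : ℝ => (t, t)) key (by fun_prop)
    · intro x
      rw [uIoc_of_le (by linarith)]
      exact hui'.1.mul (Continuous.aestronglyMeasurable (by fun_prop))
    · filter_upwards [Iio_mem_nhds (show t < t + 1 by linarith)] with x hx
      rw [uIoc_of_le (by linarith)]
      filter_upwards [ae_restrict_mem measurableSet_Ioc] with τ hτ
      rw [norm_mul]
      gcongr
      apply hM0
      have := hτ.1
      simp only [mem_Iio] at hx
      linarith
    · rw [intervalIntegrable_iff_integrableOn_Ioc_of_le (by linarith)]
      exact hui'.norm.mul_const M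
    · exact Eventually.of_forall fun τ => by fun_prop
    · constructor <;> linarith
    · constructor <;> linarith
    · simp
  intro t ht
  refine (hcont t ht).continuousWithinAt.congr (fun x hx => ?_) ?_
  all_goals
    rw [halfConv_eq]
    refine intervalIntegral.integral_congr_ae (Eventually.of_forall fun τ hτ => ?_)
    rw [uIoc_of_le (by assumption)] at hτ
    rw [hu', indicator_of_mem (show τ ∈ Ioi 0 from hτ.1), hw]
    dsimp only
    rw [max_eq_right (by linarith [hτ.2])]

/-! ### Laplace transforms of powers and of Mittag-Leffler kernels. -/

/-- The Laplace transform of the kernel of the Riemann-Liouville integral. -/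
theorem hasLaplace_rpow {β : ℝ} (hβ : 0 < β) {s : ℂ} (hs : 0 < s.re) :
    HasLaplace (fun t => ((t ^ (β - 1) : ℝ) : ℂ) / ((Real.Gamma β : ℝ) : ℂ)) s
      (Complex.exp (-(β * Complex.log s))) := by
  have hintR : ∀ r : ℝ, 0 < r → IntegrableOn (fun t : ℝ => t ^ (β - 1) * Real.exp (-(r * t)))
      (Ioi 0) := fun r hr => by
    have := integrableOn_rpow_mul_exp_neg_mul_rpow (s := β - 1) (p := 1) (b := r) (by linarith)
      one_pos hr
    simpa [neg_mul] using this
  -- For `ν = t^(β-1) dt` the transform is the complex moment generating function of `-t`, hence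
  -- analytic on `Re z > 0`. By the identity theorem it suffices to know it for real `z > 0`, where
  -- it is the Gamma integral.
  set ν : Measure ℝ := (volume.restrict (Ioi (0 : ℝ))).withDensity
    (fun t => ENNReal.ofReal (t ^ (β - 1))) with hν
  have hmeas : Measurable (fun t : ℝ => ENNReal.ofReal (t ^ (β - 1))) := by fun_prop
  have hfin : ∀ᵐ t ∂(volume.restrict (Ioi (0 : ℝ))), ENNReal.ofReal (t ^ (β - 1)) < ⊤ :=
    Eventually.of_forall fun t => ENNReal.ofReal_lt_top
  have hval : ∀ z : ℂ, ProbabilityTheory.complexMGF (fun t => -t) ν z =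
      ∫ t in Ioi (0 : ℝ), ((t ^ (β - 1) : ℝ) : ℂ) * Complex.exp (-(z * t)) := by
    intro z
    rw [ProbabilityTheory.complexMGF, hν, integral_withDensity_eq_integral_toReal_smul hmeas hfin]
    refine setIntegral_congr_fun measurableSet_Ioi fun t ht => ?_
    have : 0 ≤ t ^ (β - 1) := Real.rpow_nonneg (le_of_lt ht) _
    simp only [ENNReal.toReal_ofReal this, Complex.real_smul]
    push_cast
    rw [mul_neg]
  have hset : Ioi 0 ⊆ ProbabilityTheory.integrableExpSet (fun t => -t) ν := by
    intro r hr
    rw [ProbabilityTheory.integrableExpSet, mem_ofPred_eq, hν,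
      integrable_withDensity_iff_integrable_smul' hmeas hfin]
    refine (hintR r hr).congr_fun (fun t ht => ?_) measurableSet_Ioi
    have : 0 ≤ t ^ (β - 1) := Real.rpow_nonneg (le_of_lt ht) _
    simp only [ENNReal.toReal_ofReal this, smul_eq_mul, mul_neg]
  have hana : AnalyticOnNhd ℂ (ProbabilityTheory.complexMGF (fun t => -t) ν)
      {z | 0 < z.re} := by
    refine ProbabilityTheory.analyticOnNhd_complexMGF.mono fun z hz => ?_
    exact interior_maximal hset isOpen_Ioi hz
  have hana2 : AnalyticOnNhd ℂ (fun z => Complex.exp (-(β * Complex.log z)) *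
      ((Real.Gamma β : ℝ) : ℂ)) {z | 0 < z.re} := by
    refine DifferentiableOn.analyticOnNhd (fun z hz => ?_)
      (isOpen_lt continuous_const Complex.continuous_re)
    have : z ∈ Complex.slitPlane := Or.inl hz
    have h2 := (Complex.differentiableAt_log this)
    exact DifferentiableAt.differentiableWithinAt (by fun_prop)
  have hreal : ∀ r : ℝ, 0 < r → ProbabilityTheory.complexMGF (fun t => -t) ν r =
      Complex.exp (-(β * Complex.log r)) * ((Real.Gamma β : ℝ) : ℂ) := by
    intro r hr
    rw [hval]
    have h := Real.integral_rpow_mul_exp_neg_mul_Ioi hβ hr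
    have h2 : (∫ t in Ioi (0 : ℝ), ((t ^ (β - 1) : ℝ) : ℂ) * Complex.exp (-((r : ℂ) * t))) =
        ((∫ t in Ioi (0 : ℝ), t ^ (β - 1) * Real.exp (-(r * t)) : ℝ) : ℂ) := by
      rw [← integral_complex_ofReal]
      push_cast
      rfl
    rw [h2, h, Complex.ofReal_mul]
    congr 1
    rw [one_div, Real.inv_rpow hr.le, Real.rpow_def_of_pos hr, ← Real.exp_neg,
      ← Complex.ofReal_log hr.le]
    push_cast
    rw [mul_comm]
  have hconv : IsPreconnected {z : ℂ | 0 < z.re} := (convex_halfSpace_re_gt 0).isPreconnected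
  have heq := hana.eqOn_of_preconnected_of_frequently_eq hana2 hconv (z₀ := 1) (by simp) (by
    have ht : Tendsto (fun r : ℝ => (r : ℂ)) (𝓝[≠] 1) (𝓝[≠] 1) := by
      refine tendsto_nhdsWithin_iff.2 ⟨?_, ?_⟩
      · exact (Complex.continuous_ofReal.tendsto' 1 1 (by simp)).mono_left nhdsWithin_le_nhds
      · filter_upwards [self_mem_nhdsWithin] with r hr
        simpa using hr
    refine ht.frequently (Eventually.frequently ?_)
    filter_upwards [mem_nhdsWithin_of_mem_nhds (Ioi_mem_nhds (show (0 : ℝ) < 1 by norm_num))]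
      with r hr using hreal r hr)
  have hG : ((Real.Gamma β : ℝ) : ℂ) ≠ 0 := by
    exact_mod_cast (Real.Gamma_pos_of_pos hβ).ne'
  have main : HasLaplace (fun t => ((t ^ (β - 1) : ℝ) : ℂ)) s
      (Complex.exp (-(β * Complex.log s)) * ((Real.Gamma β : ℝ) : ℂ)) := by
    refine ⟨?_, ?_⟩
    · refine (hintR s.re hs).mono' ?_ ?_
      · refine (Continuous.aestronglyMeasurable (by fun_prop)).mul ?_
        exact (Measurable.aestronglyMeasurable (by fun_prop))
      · filter_upwards [ae_restrict_mem measurableSet_Ioi] with t ht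
        have : 0 ≤ t ^ (β - 1) := Real.rpow_nonneg (le_of_lt ht) _
        rw [norm_mul, Complex.norm_exp, Complex.norm_real, Real.norm_of_nonneg this, mul_comm]
        simp
    · simp only [mul_comm (Complex.exp _)]
      rw [← hval, heq hs, mul_comm]
  have := main.mul_const (((Real.Gamma β : ℝ) : ℂ)⁻¹)
  rw [mul_assoc, mul_inv_cancel₀ hG, mul_one] at this
  simpa only [div_eq_mul_inv] using this

/-- The transform of `‖F k‖` at `Re s` is the L¹ norm of the `k`-th weighted summand, so summability
of `‖Y k‖` justifies termwise integration. -/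
theorem hasLaplace_tsum {F : ℕ → ℝ → ℂ} {s : ℂ} {X : ℕ → ℂ} {Y : ℕ → ℂ}
    (hF : ∀ k, HasLaplace (F k) s (X k))
    (hN : ∀ k, HasLaplace (fun t => ((‖F k t‖ : ℝ) : ℂ)) s.re (Y k)) (hY : Summable fun k => ‖Y k‖)
    (hm : AEStronglyMeasurable (fun t => ∑' k, F k t) (volume.restrict (Ioi 0))) :
    HasLaplace (fun t => ∑' k, F k t) s (∑' k, X k) := by
  have hnorm : ∀ k, ∫ t in Ioi (0 : ℝ), ‖Complex.exp (-(s * t)) * F k t‖ = ‖Y k‖ := by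
    intro k
    have h1 : Y k = ((∫ t in Ioi (0 : ℝ), ‖Complex.exp (-(s * t)) * F k t‖ : ℝ) : ℂ) := by
      rw [← (hN k).2, ← integral_complex_ofReal]
      congr 1
      ext t
      rw [norm_mul, Complex.norm_exp]
      push_cast
      simp
    rw [h1, Complex.norm_real, Real.norm_of_nonneg]
    exact integral_nonneg fun t => norm_nonneg _
  have hsum : Summable fun k => ∫ t in Ioi (0 : ℝ), ‖Complex.exp (-(s * t)) * F k t‖ := by
    simpa only [hnorm] using hY
  have heq : ∀ t : ℝ, Complex.exp (-(s * t)) * ∑' k, F k t =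
      ∑' k, Complex.exp (-(s * t)) * F k t := fun t => tsum_mul_left.symm
  have hs := hasSum_integral_of_summable_integral_norm (fun k => (hF k).1) hsum
  refine ⟨⟨?_, ?_⟩, ?_⟩
  · exact (Continuous.aestronglyMeasurable (by fun_prop)).mul hm
  · simp only [heq]
    rw [hasFiniteIntegral_iff_enorm]
    calc ∫⁻ t in Ioi (0 : ℝ), ‖∑' k, Complex.exp (-(s * t)) * F k t‖ₑ
        ≤ ∫⁻ t in Ioi (0 : ℝ), ∑' k, ‖Complex.exp (-(s * t)) * F k t‖ₑ :=
          lintegral_mono fun t => enorm_tsum_le_tsum_enorm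
      _ = ∑' k, ∫⁻ t in Ioi (0 : ℝ), ‖Complex.exp (-(s * t)) * F k t‖ₑ :=
          lintegral_tsum fun k => (hF k).1.1.enorm
      _ = ∑' k, ENNReal.ofReal (∫ t in Ioi (0 : ℝ), ‖Complex.exp (-(s * t)) * F k t‖) := by
          congr 1
          ext k
          rw [ofReal_integral_norm_eq_lintegral_enorm (hF k).1]
      _ < ⊤ := by
          rw [← ENNReal.ofReal_tsum_of_nonneg
            (fun k => integral_nonneg fun t => norm_nonneg _) hsum]
          exact ENNReal.ofReal_lt_top
  · simp only [heq]
    rw [← hs.tsum_eq]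
    congr 1
    ext k
    exact (hF k).2

/-- Restrict the Gamma integral to `x > N`, where `x^(y-1) ≥ N^(y-1)`. With `N` free, this shows
that `Γ` outgrows every geometric sequence. -/
theorem rpow_mul_exp_neg_le_Gamma {N y : ℝ} (hN : 0 < N) (hy : 1 ≤ y) :
    N ^ (y - 1) * Real.exp (-N) ≤ Real.Gamma y := by
  have hG := Real.GammaIntegral_convergent (s := y) (by linarith)
  rw [Real.Gamma_eq_integral (by linarith), ← integral_exp_neg_Ioi, ← integral_const_mul]
  calc ∫ x in Ioi N, N ^ (y - 1) * Real.exp (-x)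
      ≤ ∫ x in Ioi N, Real.exp (-x) * x ^ (y - 1) := by
        refine setIntegral_mono_on ((integrableOn_exp_neg_Ioi N).const_mul _)
          (hG.mono_set (Ioi_subset_Ioi hN.le)) measurableSet_Ioi fun x hx => ?_
        rw [mul_comm]
        have hx' : N ≤ x := le_of_lt hx
        gcongr
    _ ≤ _ := by
        refine setIntegral_mono_set hG ?_ (Ioi_subset_Ioi hN.le).eventuallyLE
        filter_upwards [ae_restrict_mem measurableSet_Ioi] with x hx
        have : 0 < x := hx
        positivity

theorem summable_pow_div_Gamma {α β : ℝ} (hα : 0 < α) (hβ : 0 < β) {M : ℝ} (hM : 0 ≤ M) :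
    Summable fun k : ℕ => M ^ k / Real.Gamma (α * k + β) := by
  -- With `N^α = 2M + 1`, `Γ(αk + β)` is eventually at least a constant times `(2M + 1)^k`, so the
  -- terms are dominated by a geometric series of ratio `M/(2M + 1) < 1`.
  set N : ℝ := (2 * M + 1) ^ (1 / α) with hN
  have hN0 : 0 < N := by positivity
  have hNα : N ^ α = 2 * M + 1 := by
    rw [hN, ← Real.rpow_mul (by positivity), one_div_mul_cancel hα.ne', Real.rpow_one]
  have hgeo : Summable fun k : ℕ => (Real.exp N * N ^ (1 - β)) * (M / (2 * M + 1)) ^ k := by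
    refine (summable_geometric_of_lt_one (by positivity) ?_).mul_left _
    rw [div_lt_one (by positivity)]
    linarith
  refine hgeo.of_norm_bounded_eventually_nat ?_
  have hlim : Tendsto (fun k : ℕ => α * k + β) atTop atTop :=
    tendsto_atTop_add_const_right _ _ (tendsto_natCast_atTop_atTop.const_mul_atTop hα)
  filter_upwards [hlim.eventually_ge_atTop 1] with k hk
  have hG := rpow_mul_exp_neg_le_Gamma hN0 hk
  have hGpos : 0 < Real.Gamma (α * k + β) := Real.Gamma_pos_of_pos (by linarith)
  rw [Real.norm_of_nonneg (by positivity), div_le_iff₀ hGpos]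
  have hsplit : N ^ (α * k + β - 1) = (2 * M + 1) ^ k * N ^ (β - 1) := by
    rw [← hNα, ← Real.rpow_natCast, ← Real.rpow_mul hN0.le, ← Real.rpow_add hN0]
    congr 1; ring
  have hinv : N ^ (1 - β) * N ^ (β - 1) = 1 := by
    rw [← Real.rpow_add hN0]; simp
  have hexp : Real.exp N * Real.exp (-N) = 1 := by rw [← Real.exp_add]; simp
  calc M ^ k = (Real.exp N * Real.exp (-N)) * (N ^ (1 - β) * N ^ (β - 1)) *
        ((M / (2 * M + 1)) ^ k * (2 * M + 1) ^ k) := by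
        rw [hinv, hexp, ← mul_pow, div_mul_cancel₀ _ (by positivity)]; ring
    _ = Real.exp N * N ^ (1 - β) * (M / (2 * M + 1)) ^ k *
          (N ^ (α * k + β - 1) * Real.exp (-N)) := by rw [hsplit]; ring
    _ ≤ _ := by gcongr

theorem continuous_mittagLeffler {α β : ℝ} (hα : 0 < α) (hβ : 0 < β) :
    Continuous (mittagLeffler α β) := by
  rw [continuous_iff_continuousAt]
  intro z
  have : ContinuousOn (mittagLeffler α β) (Metric.ball 0 (‖z‖ + 1)) := by
    refine continuousOn_tsum (fun k => by fun_prop)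
      (summable_pow_div_Gamma hα hβ (M := ‖z‖ + 1) (by positivity)) fun k w hw => ?_
    have hGpos : 0 < Real.Gamma (α * k + β) := Real.Gamma_pos_of_pos (by positivity)
    rw [norm_div, norm_pow, Complex.norm_real, Real.norm_of_nonneg hGpos.le]
    gcongr
    exact le_of_lt (by simpa using hw)
  exact this.continuousAt (Metric.isOpen_ball.mem_nhds (by simp))

theorem mittagLeffler_zero_right (α : ℝ) : mittagLeffler α 1 0 = 1 := by
  rw [mittagLeffler, tsum_eq_single 0 (fun k hk => by simp [hk])]
  simp

/-- The function `t ^ (β - 1) E_{α,β}(lam t ^ α)`. -/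
def mlKernel (α β : ℝ) (lam : ℂ) (t : ℝ) : ℂ :=
  ((t ^ (β - 1) : ℝ) : ℂ) * mittagLeffler α β (lam * ((t ^ α : ℝ) : ℂ))

theorem continuousAt_mlKernel {α β : ℝ} (hα : 0 < α) (hβ : 0 < β) (lam : ℂ) {t : ℝ} (ht : 0 < t) :
    ContinuousAt (mlKernel α β lam) t := by
  have h1 : ContinuousAt (fun t : ℝ => t ^ (β - 1)) t :=
    Real.continuousAt_rpow_const _ _ (Or.inl ht.ne')
  have h2 : ContinuousAt (fun t : ℝ => t ^ α) t :=
    Real.continuousAt_rpow_const _ _ (Or.inl ht.ne')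
  have h3 := (continuous_mittagLeffler hα hβ)
  unfold mlKernel
  fun_prop

/-- The Laplace transform of `t ^ (β - 1) E_{α,β}(lam t ^ α)` is `s ^ (α - β) / (s ^ α - lam)`. -/
theorem hasLaplace_mlKernel {α β : ℝ} (hα : 0 < α) (hβ : 0 < β) {lam s : ℂ} (hs : 0 < s.re)
    (hlam : ‖lam‖ < s.re ^ α) :
    HasLaplace (mlKernel α β lam) s
      (Complex.exp (-(β * Complex.log s)) / (1 - lam * Complex.exp (-(α * Complex.log s)))) := by
  have hpos : ∀ k : ℕ, 0 < α * k + β := fun k => by positivity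
  -- Termwise transformation gives a geometric series of ratio `λ s^(-α)`.
  set F : ℕ → ℝ → ℂ := fun k t => lam ^ k *
    (((t ^ (α * k + β - 1) : ℝ) : ℂ) / ((Real.Gamma (α * k + β) : ℝ) : ℂ)) with hFdef
  have hsum : ∀ t : ℝ, 0 < t → ∑' k, F k t = mlKernel α β lam t := by
    intro t ht
    rw [mlKernel, mittagLeffler, ← tsum_mul_left]
    congr 1
    ext k
    have : t ^ (α * k + β - 1) = t ^ (β - 1) * (t ^ α) ^ k := by
      rw [← Real.rpow_natCast, ← Real.rpow_mul ht.le, ← Real.rpow_add ht]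
      congr 1; ring
    rw [hFdef]
    simp only [this]
    push_cast
    ring
  have hsplit : ∀ (k : ℕ) (w : ℂ), lam ^ k * Complex.exp (-(((α * k + β : ℝ) : ℂ) * w)) =
      Complex.exp (-(β * w)) * (lam * Complex.exp (-(α * w))) ^ k := by
    intro k w
    rw [mul_pow, ← Complex.exp_nat_mul, mul_left_comm, ← Complex.exp_add]
    congr 2
    push_cast
    ring
  have hF : ∀ k, HasLaplace (F k) s (Complex.exp (-(β * Complex.log s)) *
      (lam * Complex.exp (-(α * Complex.log s))) ^ k) := fun k =>
    ((hasLaplace_rpow (hpos k) hs).const_mul _).congr_value (hsplit k _)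
  -- The norms are transformed at `Re s`, with ratio `‖λ‖ (Re s)^(-α)`; hence the assumption on `Re
  -- s` rather than on `‖s‖`.
  have hN : ∀ k, HasLaplace (fun t => ((‖F k t‖ : ℝ) : ℂ)) s.re ((‖lam‖ : ℂ) ^ k *
      Complex.exp (-(((α * k + β : ℝ) : ℂ) * Complex.log s.re))) := by
    intro k
    refine ((hasLaplace_rpow (hpos k) (s := (s.re : ℂ)) (by simpa using hs)).const_mul _).congr
      fun t ht => ?_
    rw [hFdef]
    simp only [norm_mul, norm_pow, norm_div, Complex.norm_real]
    rw [Real.norm_of_nonneg (Real.Gamma_pos_of_pos (hpos k)).le,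
      Real.norm_of_nonneg (Real.rpow_nonneg ht.le _)]
    push_cast
    rfl
  have hexp : ∀ z : ℂ, z ≠ 0 → ‖Complex.exp (-(α * Complex.log z))‖ = (‖z‖ ^ α)⁻¹ := by
    intro z hz
    rw [Complex.norm_exp, Real.rpow_def_of_pos (norm_pos_iff.2 hz), ← Real.exp_neg]
    simp [Complex.log_re, mul_comm]
  have hs0 : s ≠ 0 := fun h => by simp [h] at hs
  have hY : Summable fun k : ℕ => ‖(‖lam‖ : ℂ) ^ k *
      Complex.exp (-(((α * k + β : ℝ) : ℂ) * Complex.log s.re))‖ := by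
    have hr : ‖lam‖ * (s.re ^ α)⁻¹ < 1 := by
      rw [← div_eq_mul_inv, div_lt_one (by positivity)]; exact hlam
    refine ((summable_geometric_of_lt_one (by positivity) hr).mul_left
      ‖Complex.exp (-(β * Complex.log s.re))‖).congr fun k => ?_
    have := congrArg norm (hsplit k (Complex.log s.re))
    rw [norm_mul, norm_pow] at this
    rw [norm_mul, norm_pow, Complex.norm_real, norm_norm, this, norm_mul, norm_pow, norm_mul,
      hexp _ (by exact_mod_cast hs.ne'), Complex.norm_real, Real.norm_of_nonneg hs.le]
  have hm : AEStronglyMeasurable (fun t => ∑' k, F k t) (volume.restrict (Ioi 0)) := by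
    have hc : ContinuousOn (mlKernel α β lam) (Ioi 0) := fun t ht =>
      (continuousAt_mlKernel hα hβ lam ht).continuousWithinAt
    refine (hc.aestronglyMeasurable measurableSet_Ioi).congr ?_
    filter_upwards [ae_restrict_mem measurableSet_Ioi] with t ht using (hsum t ht).symm
  refine ((hasLaplace_tsum hF hN hY hm).congr hsum).congr_value ?_
  rw [tsum_mul_left, tsum_geometric_of_norm_lt_one, div_eq_mul_inv]
  rw [norm_mul, hexp s hs0, ← div_eq_mul_inv, div_lt_one (by positivity)]
  refine hlam.trans_le ?_
  gcongr
  exact Complex.re_le_norm s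

/-! ### Stieltjes representation by contour integration in the coordinate `w = log s`. -/

/-- The imaginary parts differ by less than `2π`, and `c ≤ 1`, so no nonzero period fits. With `c =
a` this makes `w₀` the only zero of `exp(a w) - λ` in the strip; with `c = 1` it makes `exp w` take
the value `exp v` only at `v`. The strip of half-width `3π/2` contains the cut edges `Im w = ±π` in
its interior. -/
theorem eq_of_exp_mul_eq {c : ℝ} (hc : 0 < c) (hc1 : c ≤ 1) {w v : ℂ}
    (hw : |w.im| < 3 * Real.pi / 2) (hv : |v.im| < Real.pi / 2)
    (h : Complex.exp (c * w) = Complex.exp (c * v)) : w = v := by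
  obtain ⟨n, hn⟩ := Complex.exp_eq_exp_iff_exists_int.1 h
  have him : c * (w.im - v.im) = n * (2 * Real.pi) := by
    have := congrArg Complex.im hn
    simp at this
    linarith
  rw [abs_lt] at hw hv
  have hpi := Real.pi_pos
  have h1 : c * (w.im - v.im) < 2 * Real.pi := by nlinarith
  have h2 : -(2 * Real.pi) < c * (w.im - v.im) := by nlinarith
  have hn0 : n = 0 := by
    have h3 : (n : ℝ) < 1 := by nlinarith
    have h4 : (-1 : ℝ) < n := by nlinarith
    have h3' : n < 1 := by exact_mod_cast h3
    have h4' : -1 < n := by exact_mod_cast h4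
    omega
  rw [hn0] at hn
  simp only [Int.cast_zero, zero_mul, add_zero] at hn
  exact mul_left_cancel₀ (by exact_mod_cast hc.ne') hn

/-- The function `1 / (s ^ a - lam)` with its principal part at its pole `exp w₀` removed, in the
coordinate `w = log s`, where `lam = exp (a w₀)`. -/
def regularSymbol (a : ℝ) (w₀ w : ℂ) : ℂ :=
  1 / (Complex.exp (a * w) - Complex.exp (a * w₀)) -
    Complex.exp w₀ / (a * Complex.exp (a * w₀)) / (Complex.exp w - Complex.exp w₀)

/-- The jump of `1 / (s ^ a - lam)` across the negative axis at `s = -exp x`. -/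
def cutJump (a : ℝ) (lam : ℂ) (x : ℝ) : ℂ :=
  1 / (Complex.exp (a * (x + ((-Real.pi : ℝ) : ℂ) * Complex.I)) - lam) -
    1 / (Complex.exp (a * (x + ((Real.pi : ℝ) : ℂ) * Complex.I)) - lam)

/-- The factor `e^w / (e^w - e^(w₁))` is the Cauchy kernel `ds/(s - s₁)` in the coordinate `w`.
Subtracting the value at `w₁` cancels its pole, so Cauchy's theorem for a rectangle applies with no
residue to compute. Divided slopes supply the removable singularities. -/
theorem exists_regular_extension {a : ℝ} (ha : 0 < a) (ha1 : a ≤ 1) {w₀ w₁ : ℂ}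
    (h₀ : |w₀.im| < Real.pi / 2) (h₁ : |w₁.im| < Real.pi / 2) (hne : w₁ ≠ w₀) :
    ∃ H : ℂ → ℂ, DifferentiableOn ℂ H {w | |w.im| < 3 * Real.pi / 2} ∧
      ∀ w : ℂ, |w.im| < 3 * Real.pi / 2 → w ≠ w₀ → w ≠ w₁ →
        H w = (regularSymbol a w₀ w - regularSymbol a w₀ w₁) *
          (Complex.exp w / (Complex.exp w - Complex.exp w₁)) := by
  have hpi := Real.pi_pos
  set U : Set ℂ := {w | |w.im| < 3 * Real.pi / 2} with hU
  have hUo : IsOpen U := isOpen_lt (by fun_prop) continuous_const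
  have hU₀ : w₀ ∈ U := by rw [hU, mem_ofPred_eq]; linarith
  have hU₁ : w₁ ∈ U := by rw [hU, mem_ofPred_eq]; linarith
  have hac : (a : ℂ) ≠ 0 := by exact_mod_cast ha.ne'
  set b : ℂ := Complex.exp w₀ / (a * Complex.exp (a * w₀)) with hb
  set A : ℂ → ℂ := dslope (fun w => Complex.exp (a * w)) w₀ with hA
  set B : ℂ → ℂ := dslope Complex.exp w₀ with hB
  set C : ℂ → ℂ := dslope Complex.exp w₁ with hC
  have hderiv : ∀ w : ℂ, deriv (fun w : ℂ => Complex.exp (a * w)) w = a * Complex.exp (a * w) := by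
    intro w
    have : HasDerivAt (fun w : ℂ => Complex.exp (a * w)) (Complex.exp (a * w) * (a * 1)) w :=
      ((hasDerivAt_id w).const_mul (a : ℂ)).cexp
    rw [this.deriv]; ring
  have hexp' : ∀ v ∈ U, |v.im| < Real.pi / 2 → ∀ w ∈ U, dslope Complex.exp v w ≠ 0 := by
    intro v _ hv w hw
    by_cases h : w = v
    · rw [h, dslope_same]; simp
    · intro h0
      have := sub_smul_dslope Complex.exp v w
      rw [h0, smul_zero] at this
      exact h (eq_of_exp_mul_eq one_pos le_rfl hw hv (by simpa [sub_eq_zero, eq_comm] using this))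
  have hAne : ∀ w ∈ U, A w ≠ 0 := by
    intro w hw
    by_cases h : w = w₀
    · rw [h, hA, dslope_same, hderiv]
      exact mul_ne_zero hac (Complex.exp_ne_zero _)
    · intro h0
      have := sub_smul_dslope (fun w : ℂ => Complex.exp (a * w)) w₀ w
      rw [← hA, h0, smul_zero] at this
      exact h (eq_of_exp_mul_eq ha ha1 hw h₀ (sub_eq_zero.1 this.symm))
  have hAd : DifferentiableOn ℂ A U :=
    (Complex.differentiableOn_dslope (hUo.mem_nhds hU₀)).2 (by fun_prop)
  have hBd : DifferentiableOn ℂ B U :=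
    (Complex.differentiableOn_dslope (hUo.mem_nhds hU₀)).2 (by fun_prop)
  have hCd : DifferentiableOn ℂ C U :=
    (Complex.differentiableOn_dslope (hUo.mem_nhds hU₁)).2 (by fun_prop)
  -- `1/((w - w₀) A) - b/((w - w₀) B) = N/((w - w₀) A B)`, and `b` is exactly the constant with `N
  -- w₀ = 0`.
  set N : ℂ → ℂ := fun w => B w - b * A w with hN
  have hN0 : N w₀ = 0 := by
    simp only [hN, hB, hA, dslope_same, hderiv, hb, Complex.deriv_exp]
    field_simp
    simp
  have hSd : DifferentiableOn ℂ (dslope N w₀) U :=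
    (Complex.differentiableOn_dslope (hUo.mem_nhds hU₀)).2 (by fun_prop)
  set g : ℂ → ℂ := fun w => dslope N w₀ w / (A w * B w) with hg
  have hgd : DifferentiableOn ℂ g U :=
    hSd.div (hAd.mul hBd) fun w hw => mul_ne_zero (hAne w hw) (hexp' w₀ hU₀ h₀ w hw)
  have hgeq : ∀ w ∈ U, w ≠ w₀ → g w = regularSymbol a w₀ w := by
    intro w hw hw0
    have hd : w - w₀ ≠ 0 := sub_ne_zero.2 hw0
    have h1 := sub_smul_dslope (fun w : ℂ => Complex.exp (a * w)) w₀ w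
    have h2 := sub_smul_dslope Complex.exp w₀ w
    have h3 := sub_smul_dslope N w₀ w
    rw [hN0, sub_zero] at h3
    rw [← hA, smul_eq_mul] at h1
    rw [← hB, smul_eq_mul] at h2
    rw [smul_eq_mul] at h3
    have hA0 := hAne w hw
    have hB0 : B w ≠ 0 := hexp' w₀ hU₀ h₀ w hw
    rw [regularSymbol, ← hb, ← h1, ← h2]
    simp only [hg]
    rw [div_sub_div _ _ (mul_ne_zero hd hA0) (mul_ne_zero hd hB0),
      div_eq_div_iff (mul_ne_zero hA0 hB0)
        (mul_ne_zero (mul_ne_zero hd hA0) (mul_ne_zero hd hB0))]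
    simp only [hN] at h3
    linear_combination (w - w₀) * A w * B w * h3
  refine ⟨fun w => dslope g w₁ w * Complex.exp w / C w, ?_, ?_⟩
  · have h4 : DifferentiableOn ℂ (dslope g w₁) U :=
      (Complex.differentiableOn_dslope (hUo.mem_nhds hU₁)).2 hgd
    exact (h4.mul (by fun_prop)).div hCd fun w hw => hexp' w₁ hU₁ h₁ w hw
  · intro w hw hw0 hw1
    have hd : w - w₁ ≠ 0 := sub_ne_zero.2 hw1
    have h2 := sub_smul_dslope Complex.exp w₁ w
    have h3 := sub_smul_dslope g w₁ w
    have hC0 : C w ≠ 0 := hexp' w₁ hU₁ h₁ w hw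
    rw [← hC, smul_eq_mul] at h2
    rw [smul_eq_mul] at h3
    rw [← hgeq w hw hw0, ← hgeq w₁ hU₁ hne, ← h2, ← h3]
    field_simp

/-- A limit along `comap Complex.re l` is uniform in the imaginary part, so it passes to vertical
segments of length `2π`. -/
theorem tendsto_integral_vertical {K : ℂ → ℂ} {l : Filter ℝ} [l.IsCountablyGenerated] {c : ℂ}
    (hm : Measurable K) (h : Tendsto K (comap Complex.re l) (𝓝 c)) :
    Tendsto (fun L : ℝ => ∫ y in (-Real.pi)..Real.pi, K (L + y * Complex.I)) l
      (𝓝 (2 * Real.pi * c)) := by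
  have hc : ∫ _ in (-Real.pi)..Real.pi, c = 2 * Real.pi * c := by
    rw [intervalIntegral.integral_const, Complex.real_smul]
    push_cast; ring
  rw [← hc]
  refine intervalIntegral.tendsto_integral_filter_of_dominated_convergence (fun _ => ‖c‖ + 1)
    (Eventually.of_forall fun L => ?_) ?_ intervalIntegrable_const
    (Eventually.of_forall fun y _ => ?_)
  · exact (hm.comp (by fun_prop)).aestronglyMeasurable
  · have : ∀ᶠ w in comap Complex.re l, ‖K w‖ ≤ ‖c‖ + 1 := by
      filter_upwards [h.norm.eventually (gt_mem_nhds (lt_add_one ‖c‖))] with w hw using hw.le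
    filter_upwards [eventually_comap.1 this] with L hL
    exact Eventually.of_forall fun y _ => hL _ (by simp)
  · refine h.comp (tendsto_comap_iff.2 ?_)
    refine tendsto_id.congr fun L => ?_
    simp

theorem tendsto_real_mul_comap_re {a : ℝ} (ha : 0 < a) :
    Tendsto (fun w : ℂ => (a : ℂ) * w) (comap Complex.re atTop) (comap Complex.re atTop) ∧
    Tendsto (fun w : ℂ => (a : ℂ) * w) (comap Complex.re atBot) (comap Complex.re atBot) := by
  constructor
  · refine tendsto_comap_iff.2 ?_
    have : Tendsto (fun w : ℂ => a * w.re) (comap Complex.re atTop) atTop :=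
      tendsto_comap.const_mul_atTop ha
    exact this.congr fun w => by simp
  · refine tendsto_comap_iff.2 ?_
    have : Tendsto (fun w : ℂ => a * w.re) (comap Complex.re atBot) atBot :=
      tendsto_comap.const_mul_atBot ha
    exact this.congr fun w => by simp

/-- The symbol tends to `0` and the Cauchy factor to `1`. This right edge is what produces the value
at `w₁` in the representation; the left edge contributes nothing. -/
theorem tendsto_regular_right {a : ℝ} (ha : 0 < a) (w₀ w₁ : ℂ) :
    Tendsto (fun w => (regularSymbol a w₀ w - regularSymbol a w₀ w₁) *
      (Complex.exp w / (Complex.exp w - Complex.exp w₁))) (comap Complex.re atTop)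
      (𝓝 (-regularSymbol a w₀ w₁)) := by
  have h1 := Complex.tendsto_exp_comap_re_atTop
  have h2 := h1.comp (tendsto_real_mul_comap_re ha).1
  have hinv : ∀ {f : ℂ → ℂ} (c : ℂ), Tendsto f (comap Complex.re atTop) (Bornology.cobounded ℂ) →
      Tendsto (fun w => (f w - c)⁻¹) (comap Complex.re atTop) (𝓝 0) := fun c hf =>
    (tendsto_inv₀_cobounded.comp (tendsto_sub_const_cobounded c)).comp hf
  have h3 := hinv (Complex.exp (a * w₀)) h2
  have h4 := hinv (Complex.exp w₀) h1
  have h5 := hinv (Complex.exp w₁) h1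
  have hr : Tendsto (regularSymbol a w₀) (comap Complex.re atTop) (𝓝 0) := by
    have := h3.sub (h4.const_mul (Complex.exp w₀ / (a * Complex.exp (a * w₀))))
    simp only [mul_zero, sub_zero] at this
    refine this.congr fun w => ?_
    simp [regularSymbol, div_eq_mul_inv]
  have hq : Tendsto (fun w => Complex.exp w / (Complex.exp w - Complex.exp w₁))
      (comap Complex.re atTop) (𝓝 1) := by
    have := (h5.const_mul (Complex.exp w₁)).const_add 1
    simp only [mul_zero, add_zero] at this
    refine this.congr' ?_
    have hne : ∀ᶠ w in comap Complex.re atTop, Complex.exp w - Complex.exp w₁ ≠ 0 := by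
      filter_upwards [tendsto_comap.eventually (eventually_gt_atTop w₁.re)] with w hw h0
      have := congrArg norm (sub_eq_zero.1 h0)
      rw [Complex.norm_exp, Complex.norm_exp, Real.exp_eq_exp] at this
      exact hw.ne' this
    filter_upwards [hne] with w hw
    field_simp
    ring
  simpa using (hr.sub_const (regularSymbol a w₀ w₁)).mul hq

theorem tendsto_regularSymbol_left {a : ℝ} (ha : 0 < a) (w₀ : ℂ) :
    Tendsto (regularSymbol a w₀) (comap Complex.re atBot)
      (𝓝 (1 / (0 - Complex.exp (a * w₀)) -
        Complex.exp w₀ / (a * Complex.exp (a * w₀)) / (0 - Complex.exp w₀))) := by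
  have h1 : Tendsto Complex.exp (comap Complex.re atBot) (𝓝 0) :=
    Complex.tendsto_exp_comap_re_atBot
  have h2 := h1.comp (tendsto_real_mul_comap_re ha).2
  exact (tendsto_const_nhds.div (h2.sub_const _) (by simp)).sub
    (tendsto_const_nhds.div (h1.sub_const _) (by simp))

theorem tendsto_regular_left {a : ℝ} (ha : 0 < a) (w₀ w₁ : ℂ) :
    Tendsto (fun w => (regularSymbol a w₀ w - regularSymbol a w₀ w₁) *
      (Complex.exp w / (Complex.exp w - Complex.exp w₁))) (comap Complex.re atBot) (𝓝 0) := by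
  have h1 : Tendsto Complex.exp (comap Complex.re atBot) (𝓝 0) :=
    Complex.tendsto_exp_comap_re_atBot
  have hq : Tendsto (fun w => Complex.exp w / (Complex.exp w - Complex.exp w₁))
      (comap Complex.re atBot) (𝓝 0) := by
    have := h1.div (h1.sub_const (Complex.exp w₁)) (by simp)
    rw [zero_div] at this
    exact this
  simpa using ((tendsto_regularSymbol_left ha w₀).sub_const (regularSymbol a w₀ w₁)).mul hq

theorem measurable_regularSymbol (a : ℝ) (w₀ : ℂ) : Measurable (regularSymbol a w₀) := by
  unfold regularSymbol
  fun_prop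

theorem cut_denominator_ne {a : ℝ} (ha : 0 < a) (ha1 : a ≤ 1) {w₀ : ℂ}
    (h₀ : |w₀.im| < Real.pi / 2) (x : ℝ) {y : ℝ} (hy : |y| = Real.pi) :
    Complex.exp (a * (x + (y : ℂ) * Complex.I)) - Complex.exp (a * w₀) ≠ 0 := by
  intro h
  have hpi := Real.pi_pos
  have := eq_of_exp_mul_eq ha ha1 (w := x + (y : ℂ) * Complex.I) (by simp [hy]; linarith) h₀
    (sub_eq_zero.1 h)
  rw [← this] at h₀
  simp [hy] at h₀
  linarith

theorem continuous_cutJump {a : ℝ} (ha : 0 < a) (ha1 : a ≤ 1) {w₀ : ℂ}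
    (h₀ : |w₀.im| < Real.pi / 2) : Continuous (cutJump a (Complex.exp (a * w₀))) := by
  have hpi := Real.pi_pos
  unfold cutJump
  refine Continuous.sub ?_ ?_
  · exact continuous_const.div (by fun_prop) fun x => cut_denominator_ne ha ha1 h₀ x
      (by rw [abs_neg, abs_of_pos hpi])
  · exact continuous_const.div (by fun_prop) fun x => cut_denominator_ne ha ha1 h₀ x
      (abs_of_pos hpi)

/-- At `+∞` each term is `O(e^(-ax))`. At `-∞` each term tends to `-1/λ` and only the difference
decays: over a common denominator its numerator is `O(e^(ax))`. -/
theorem integrable_cutJump {a : ℝ} (ha : 0 < a) (ha1 : a ≤ 1) {w₀ : ℂ}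
    (h₀ : |w₀.im| < Real.pi / 2) : Integrable (cutJump a (Complex.exp (a * w₀))) := by
  have hpi := Real.pi_pos
  have hc := continuous_cutJump ha ha1 h₀
  set lam := Complex.exp (a * w₀) with hlam
  have hlam0 : lam ≠ 0 := Complex.exp_ne_zero _
  have hnorm : ∀ x y : ℝ, ‖Complex.exp (a * (x + (y : ℂ) * Complex.I))‖ = Real.exp (a * x) := by
    intro x y; rw [Complex.norm_exp]; simp
  have htop : cutJump a lam =O[atTop] fun x : ℝ => Real.exp (-a * x) := by
    have hlim : Tendsto (fun x : ℝ => Real.exp (a * x)) atTop atTop :=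
      Real.tendsto_exp_atTop.comp (tendsto_id.const_mul_atTop ha)
    have hone : ∀ y : ℝ, (fun x : ℝ => 1 / (Complex.exp (a * (x + (y : ℂ) * Complex.I)) - lam))
        =O[atTop] fun x : ℝ => Real.exp (-a * x) := by
      intro y
      refine Asymptotics.IsBigO.of_bound 2 ?_
      filter_upwards [hlim.eventually_gt_atTop (2 * ‖lam‖)] with x hx
      have h1 := norm_sub_norm_le (Complex.exp (a * (x + (y : ℂ) * Complex.I))) lam
      rw [hnorm] at h1
      have h2 : Real.exp (a * x) / 2 ≤ ‖Complex.exp (a * (x + (y : ℂ) * Complex.I)) - lam‖ := by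
        linarith
      have h3 := Real.exp_pos (a * x)
      rw [norm_div, norm_one, Real.norm_of_nonneg (Real.exp_pos _).le, neg_mul, Real.exp_neg]
      calc 1 / ‖Complex.exp (a * (x + (y : ℂ) * Complex.I)) - lam‖
          ≤ 1 / (Real.exp (a * x) / 2) := by gcongr
        _ = _ := by field_simp
    exact (hone _).sub (hone _)
  have hbot : cutJump a lam =O[atBot] fun x : ℝ => Real.exp (a * x) := by
    have hlim : ∀ y : ℝ, Tendsto (fun x : ℝ => Complex.exp (a * (x + (y : ℂ) * Complex.I)))
        atBot (𝓝 0) := by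
      intro y
      rw [tendsto_zero_iff_norm_tendsto_zero]
      simp only [hnorm]
      exact Real.tendsto_exp_atBot.comp (tendsto_id.const_mul_atBot ha)
    have hden : ∀ y : ℝ, (fun x : ℝ => 1 / (Complex.exp (a * (x + (y : ℂ) * Complex.I)) - lam))
        =O[atBot] fun _ : ℝ => (1 : ℝ) := fun y =>
      (tendsto_const_nhds.div ((hlim y).sub_const lam) (by simpa using hlam0)).isBigO_one ℝ
    have hnum : ∀ y : ℝ, (fun x : ℝ => Complex.exp (a * (x + (y : ℂ) * Complex.I)))
        =O[atBot] fun x : ℝ => Real.exp (a * x) := by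
      intro y
      refine Asymptotics.IsBigO.of_bound 1 (Eventually.of_forall fun x => ?_)
      rw [hnorm, Real.norm_of_nonneg (Real.exp_pos _).le, one_mul]
    have := (((hnum Real.pi).sub (hnum (-Real.pi))).mul (hden (-Real.pi))).mul (hden Real.pi)
    simp only [mul_one] at this
    refine this.congr_left fun x => ?_
    have e1 := cut_denominator_ne ha ha1 h₀ x (y := -Real.pi) (by rw [abs_neg, abs_of_pos hpi])
    have e2 := cut_denominator_ne ha ha1 h₀ x (y := Real.pi) (abs_of_pos hpi)
    rw [← hlam] at e1 e2
    rw [cutJump, div_sub_div _ _ e1 e2, mul_one_div, mul_one_div, div_div]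
    congr 1
    ring
  refine hc.locallyIntegrable.integrable_of_isBigO_atBot_atTop hbot ?_ htop ?_
  · exact ⟨Iic 0, Iic_mem_atBot 0, integrableOn_exp_mul_Iic ha 0⟩
  · exact ⟨Ioi 0, Ioi_mem_atTop 0, integrableOn_exp_mul_Ioi (by linarith) 0⟩

theorem re_add_exp_le_norm (x : ℝ) (s : ℂ) :
    s.re + Real.exp x ≤ ‖s + ((Real.exp x : ℝ) : ℂ)‖ := by
  have := Complex.re_le_norm (s + ((Real.exp x : ℝ) : ℂ))
  rwa [Complex.add_re, Complex.ofReal_re] at this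

theorem integrable_cutJump_mul {a : ℝ} (ha : 0 < a) (ha1 : a ≤ 1) {w₀ : ℂ}
    (h₀ : |w₀.im| < Real.pi / 2) {s : ℂ} (hs : 0 ≤ s.re) :
    Integrable fun x : ℝ => cutJump a (Complex.exp (a * w₀)) x *
      (((Real.exp x : ℝ) : ℂ) / (s + ((Real.exp x : ℝ) : ℂ))) := by
  have hne : ∀ x : ℝ, s + ((Real.exp x : ℝ) : ℂ) ≠ 0 := fun x => by
    have := re_add_exp_le_norm x s
    have := Real.exp_pos x
    exact norm_pos_iff.1 (by linarith)
  refine (integrable_cutJump ha ha1 h₀).mul_bdd (c := 1) ?_ (Eventually.of_forall fun x => ?_)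
  · refine Continuous.aestronglyMeasurable (Continuous.div (by fun_prop) (by fun_prop) hne)
  · have := re_add_exp_le_norm x s
    rw [norm_div, Complex.norm_real, Real.norm_of_nonneg (Real.exp_pos x).le]
    exact div_le_one_of_le₀ (by linarith) (norm_nonneg _)

/-- The Stieltjes representation of `1 / (s ^ a - lam)` minus its principal part. -/
theorem integral_cutJump_mul {a : ℝ} (ha : 0 < a) (ha1 : a ≤ 1) {w₀ w₁ : ℂ}
    (h₀ : |w₀.im| < Real.pi / 2) (h₁ : |w₁.im| < Real.pi / 2) (hne : w₁ ≠ w₀) :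
    ∫ x : ℝ, cutJump a (Complex.exp (a * w₀)) x *
      (((Real.exp x : ℝ) : ℂ) / (Complex.exp w₁ + ((Real.exp x : ℝ) : ℂ))) =
      2 * Real.pi * Complex.I * regularSymbol a w₀ w₁ := by
  have hpi := Real.pi_pos
  have hre : 0 ≤ (Complex.exp w₁).re := by
    rw [Complex.exp_re]
    have := Real.cos_pos_of_mem_Ioo (abs_lt.1 h₁ |> fun h => ⟨by linarith [h.1], h.2⟩)
    positivity
  set J : ℝ → ℂ := fun x => cutJump a (Complex.exp (a * w₀)) x *
      (((Real.exp x : ℝ) : ℂ) / (Complex.exp w₁ + ((Real.exp x : ℝ) : ℂ))) with hJ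
  have hJi : Integrable J := integrable_cutJump_mul ha ha1 h₀ hre
  obtain ⟨H, hHd, hHeq⟩ := exists_regular_extension ha ha1 h₀ h₁ hne
  set K : ℂ → ℂ := fun w => (regularSymbol a w₀ w - regularSymbol a w₀ w₁) *
    (Complex.exp w / (Complex.exp w - Complex.exp w₁)) with hK
  have hKm : Measurable K := by
    have := measurable_regularSymbol a w₀
    fun_prop
  have hright := tendsto_integral_vertical hKm (tendsto_regular_right ha w₀ w₁)
  have hleft := (tendsto_integral_vertical hKm (tendsto_regular_left ha w₀ w₁)).comp
    tendsto_neg_atTop_atBot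
  have hmid := intervalIntegral_tendsto_integral hJi tendsto_neg_atTop_atBot tendsto_id
  have hsub : ∀ L : ℝ, uIcc (-L) L ×ℂ uIcc (-Real.pi) Real.pi ⊆ {w | |w.im| < 3 * Real.pi / 2} := by
    intro L w hw
    have h := hw.2
    rw [mem_preimage, uIcc_of_le (by linarith)] at h
    have := abs_le.2 h
    rw [mem_ofPred_eq]
    linarith
  have hline : ∀ y : ℝ, |y| = Real.pi → Continuous fun x : ℝ => H (x + (y : ℂ) * Complex.I) := by
    intro y hy
    refine hHd.continuousOn.comp_continuous (by fun_prop) fun x => ?_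
    rw [mem_ofPred_eq]
    simp [hy]
    linarith
  have hlineeq : ∀ y : ℝ, |y| = Real.pi → ∀ x : ℝ, H (x + (y : ℂ) * Complex.I) =
      K (x + (y : ℂ) * Complex.I) := by
    intro y hy x
    refine hHeq _ (by simp [hy]; linarith) ?_ ?_
    · intro h; rw [← h] at h₀; simp [hy] at h₀; linarith
    · intro h; rw [← h] at h₁; simp [hy] at h₁; linarith
  have hvert : ∀ᶠ L : ℝ in atTop, ∀ M : ℝ, |M| = L →
      ∫ y in (-Real.pi)..Real.pi, H (M + y * Complex.I) =
      ∫ y in (-Real.pi)..Real.pi, K (M + y * Complex.I) := by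
    filter_upwards [eventually_gt_atTop |w₀.re|, eventually_gt_atTop |w₁.re|] with L hL0 hL1 M hM
    refine intervalIntegral.integral_congr fun y hy => ?_
    rw [uIcc_of_le (by linarith)] at hy
    have := abs_le.2 hy
    refine hHeq _ (by simp; linarith) ?_ ?_
    · intro h; rw [← h] at hL0; simp [hM] at hL0
    · intro h; rw [← h] at hL1; simp [hM] at hL1
  have hexp : ∀ x : ℝ, ∀ y : ℝ, |y| = Real.pi →
      Complex.exp (x + (y : ℂ) * Complex.I) = -((Real.exp x : ℝ) : ℂ) := by
    intro x y hy
    rw [Complex.exp_add, Complex.ofReal_exp]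
    rcases (abs_eq hpi.le).1 hy with h | h
    · rw [h, Complex.exp_pi_mul_I]; ring
    · rw [h]; push_cast; rw [neg_mul, Complex.exp_neg, Complex.exp_pi_mul_I]; norm_num
  -- Cauchy's theorem on the rectangle `[-L, L] × [-π, π]`. On both horizontal edges `e^w = -e^x`,
  -- so the principal part and the value at `w₁` cancel between them and only the jump survives.
  have hzero : ∀ᶠ L : ℝ in atTop, (∫ x in (-L)..L, J x) +
      Complex.I • (∫ y in (-Real.pi)..Real.pi, K (L + y * Complex.I)) -
      Complex.I • (∫ y in (-Real.pi)..Real.pi, K (((-L : ℝ) : ℂ) + y * Complex.I)) = 0 := by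
    filter_upwards [hvert, eventually_ge_atTop 0] with L hL hL0
    rw [← hL L (abs_of_nonneg hL0), ← hL (-L) (by rw [abs_neg, abs_of_nonneg hL0])]
    have hr := Complex.integral_boundary_rect_eq_zero_of_differentiableOn H
      (⟨-L, -Real.pi⟩ : ℂ) (⟨L, Real.pi⟩ : ℂ) (hHd.mono (hsub L))
    simp only at hr
    rw [← hr]
    congr 2
    have e1 : |(-Real.pi)| = Real.pi := by rw [abs_neg, abs_of_pos hpi]
    have e2 : |Real.pi| = Real.pi := abs_of_pos hpi
    rw [← intervalIntegral.integral_sub ((hline _ e1).intervalIntegrable _ _)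
      ((hline _ e2).intervalIntegrable _ _)]
    refine intervalIntegral.integral_congr fun x _ => ?_
    simp only [hlineeq _ e1, hlineeq _ e2, hK, hexp _ _ e1, hexp _ _ e2, hJ, cutJump,
      regularSymbol]
    rw [show -((Real.exp x : ℝ) : ℂ) - Complex.exp w₁ =
      -(Complex.exp w₁ + ((Real.exp x : ℝ) : ℂ)) by ring, neg_div_neg_eq]
    ring
  have hlim := (hmid.add (hright.const_smul Complex.I)).sub (hleft.const_smul Complex.I)
  have hlim0 := tendsto_nhds_unique (hlim.congr' (by
    filter_upwards [hzero] with L hL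
    simpa using hL)) tendsto_const_nhds
  simp only [smul_eq_mul, mul_zero, sub_zero] at hlim0
  linear_combination hlim0

/-! ### Superpositions of decaying exponentials. -/

/-- The superposition `∫ exp(-exp(x) t) h(x) dx` of decaying exponentials. -/
def expMixture (h : ℝ → ℂ) (t : ℝ) : ℂ :=
  ∫ x : ℝ, Complex.exp (-(((Real.exp x : ℝ) : ℂ) * t)) * h x

theorem norm_exp_neg_exp_mul (x t : ℝ) :
    ‖Complex.exp (-(((Real.exp x : ℝ) : ℂ) * t))‖ = Real.exp (-(Real.exp x * t)) := by
  rw [← Complex.ofReal_mul, ← Complex.ofReal_neg, ← Complex.ofReal_exp, Complex.norm_real,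
    Real.norm_of_nonneg (Real.exp_pos _).le]

theorem norm_exp_neg_exp_mul_le_one (x : ℝ) {t : ℝ} (ht : 0 ≤ t) :
    ‖Complex.exp (-(((Real.exp x : ℝ) : ℂ) * t))‖ ≤ 1 := by
  rw [norm_exp_neg_exp_mul, Real.exp_le_one_iff]
  have := Real.exp_pos x
  nlinarith

/-- Fubini, with `∫_0^∞ e^(-(s + e^x)t) dt = 1/(s + e^x)`. The case `Re s = 0` is included because
`s = 0` later yields integrability of the kernel remainder. -/
theorem hasLaplace_expMixture {h : ℝ → ℂ} (hc : Continuous h) {s : ℂ} (hs : 0 ≤ s.re)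
    (hi : Integrable fun x : ℝ => ‖h x‖ / (s.re + Real.exp x)) :
    HasLaplace (expMixture h) s (∫ x : ℝ, h x / (s + ((Real.exp x : ℝ) : ℂ))) := by
  set G : ℝ × ℝ → ℂ := fun p => Complex.exp (-(s * p.1)) *
    (Complex.exp (-(((Real.exp p.2 : ℝ) : ℂ) * p.1)) * h p.2) with hG
  have hGx : ∀ t x : ℝ, G (t, x) = Complex.exp (-(s + ((Real.exp x : ℝ) : ℂ)) * t) * h x := by
    intro t x
    simp only [hG]
    rw [← mul_assoc, ← Complex.exp_add]
    congr 2; ring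
  have hre : ∀ x : ℝ, (-(s + ((Real.exp x : ℝ) : ℂ))).re = -(s.re + Real.exp x) := by
    intro x; rw [Complex.neg_re, Complex.add_re, Complex.ofReal_re]
  have hneg : ∀ x : ℝ, (-(s + ((Real.exp x : ℝ) : ℂ))).re < 0 := by
    intro x; rw [hre]; have := Real.exp_pos x; linarith
  have hGint : Integrable G ((volume.restrict (Ioi (0 : ℝ))).prod volume) := by
    rw [integrable_prod_iff' (Continuous.aestronglyMeasurable (by fun_prop))]
    refine ⟨Eventually.of_forall fun x => ?_, ?_⟩
    · simp only [hGx]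
      exact Integrable.mul_const (integrableOn_exp_mul_complex_Ioi (hneg x) 0) _
    · refine hi.congr (Eventually.of_forall fun x => ?_)
      have hn : ∀ t : ℝ, ‖G (t, x)‖ = Real.exp (-(s.re + Real.exp x) * t) * ‖h x‖ := by
        intro t
        rw [hGx, norm_mul, Complex.norm_exp, ← hre]
        simp
      have h0 : -(s.re + Real.exp x) < 0 := by rw [← hre]; exact hneg x
      simp only [hn]
      rw [integral_mul_const, integral_exp_mul_Ioi h0]
      simp only [mul_zero, Real.exp_zero, neg_div_neg_eq]
      rw [div_mul_eq_mul_div, one_mul]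
  have hin : ∀ t : ℝ, ∫ x : ℝ, G (t, x) = Complex.exp (-(s * t)) * expMixture h t := by
    intro t
    simp only [hG]
    rw [integral_const_mul, expMixture]
  constructor
  · have := hGint.integral_prod_left
    simp only [hin] at this
    exact this
  · simp only [← hin]
    rw [integral_integral_swap (f := fun t x => G (t, x)) hGint]
    congr 1
    ext x
    simp only [hGx]
    rw [integral_mul_const, integral_exp_mul_complex_Ioi (hneg x)]
    simp only [Complex.ofReal_zero, mul_zero, Complex.exp_zero, neg_div_neg_eq]
    rw [div_mul_eq_mul_div, one_mul]

theorem continuousAt_expMixture {h : ℝ → ℂ} (hc : Continuous h)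
    (hi : ∀ c : ℝ, 0 < c → Integrable fun x : ℝ => Real.exp (-(Real.exp x * c)) * ‖h x‖)
    {t : ℝ} (ht : 0 < t) : ContinuousAt (expMixture h) t := by
  refine continuousAt_of_dominated (Eventually.of_forall fun y =>
    Continuous.aestronglyMeasurable (by fun_prop)) ?_ (hi (t / 2) (by linarith))
    (Eventually.of_forall fun x => by fun_prop)
  filter_upwards [Ioi_mem_nhds (show t / 2 < t by linarith)] with y hy
  refine Eventually.of_forall fun x => ?_
  rw [norm_mul, norm_exp_neg_exp_mul]
  have hy' : t / 2 ≤ y := le_of_lt hy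
  gcongr

theorem norm_expMixture_le {h : ℝ → ℂ} (hi : Integrable h) {t : ℝ} (ht : 0 ≤ t) :
    ‖expMixture h t‖ ≤ ∫ x, ‖h x‖ := by
  refine norm_integral_le_of_norm_le hi.norm (Eventually.of_forall fun x => ?_)
  rw [norm_mul]
  exact mul_le_of_le_one_left (norm_nonneg _) (norm_exp_neg_exp_mul_le_one x ht)

theorem tendsto_expMixture {h : ℝ → ℂ} (hc : Continuous h) (hi : Integrable h) :
    Tendsto (expMixture h) atTop (𝓝 0) := by
  have h0 : (0 : ℂ) = ∫ _ : ℝ, (0 : ℂ) := by simp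
  rw [h0]
  refine tendsto_integral_filter_of_dominated_convergence (fun x => ‖h x‖)
    (Eventually.of_forall fun y => Continuous.aestronglyMeasurable (by fun_prop)) ?_ hi.norm
    (Eventually.of_forall fun x => ?_)
  · filter_upwards [eventually_ge_atTop 0] with t ht
    refine Eventually.of_forall fun x => ?_
    rw [norm_mul]
    exact mul_le_of_le_one_left (norm_nonneg _) (norm_exp_neg_exp_mul_le_one x ht)
  · rw [← zero_mul (h x)]
    refine Tendsto.mul_const _ ?_
    rw [tendsto_zero_iff_norm_tendsto_zero]
    simp only [norm_exp_neg_exp_mul]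
    exact Real.tendsto_exp_atBot.comp (tendsto_neg_atTop_atBot.comp
      (tendsto_id.const_mul_atTop (Real.exp_pos x)))

/-! ### Splitting the Mittag-Leffler kernels into exponential and remainder. -/

/-- The part of `t ^ (a - 1) E_{a,a}(lam t ^ a)` that is integrable on the half-line. -/
def kernelRemainder (a : ℝ) (lam : ℂ) (t : ℝ) : ℂ :=
  1 / (2 * Real.pi * Complex.I) *
    expMixture (fun x => cutJump a lam x * ((Real.exp x : ℝ) : ℂ)) t

/-- The part of `E_a(lam t ^ a)` that vanishes at infinity. -/
def solutionRemainder (a : ℝ) (lam : ℂ) (t : ℝ) : ℂ :=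
  -(lam / (2 * Real.pi * Complex.I)) * expMixture (cutJump a lam) t

theorem exists_abscissa {a : ℝ} (ha : 0 < a) (w m : ℂ) :
    ∃ σ : ℝ, 0 < σ ∧ w.re < σ ∧ ‖m‖ < σ ^ a := by
  have := ((tendsto_rpow_atTop ha).eventually_gt_atTop ‖m‖).and
    ((eventually_gt_atTop (0 : ℝ)).and (eventually_gt_atTop w.re))
  obtain ⟨σ, h1, h2, h3⟩ := this.exists
  exact ⟨σ, h2, h3, h1⟩

theorem exp_mul_log_ne {a : ℝ} (ha : 0 < a) (ha1 : a ≤ 1) {w₀ : ℂ}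
    (h₀ : |w₀.im| < Real.pi / 2)
    {s : ℂ} (hs : 0 < s.re) (hne : s ≠ Complex.exp w₀) :
    Complex.exp (a * Complex.log s) ≠ Complex.exp (a * w₀) := by
  intro h
  have hs0 : s ≠ 0 := Complex.ne_zero_of_re_pos hs
  have him : |(Complex.log s).im| < Real.pi / 2 := by
    rw [Complex.log_im]
    exact Complex.abs_arg_lt_pi_div_two_iff.2 (Or.inl hs)
  have := eq_of_exp_mul_eq ha ha1 (by have := Real.pi_pos; linarith) h₀ h
  exact hne (by rw [← this, Complex.exp_log hs0])

theorem integral_cutJump_mul_log {a : ℝ} (ha : 0 < a) (ha1 : a ≤ 1) {w₀ : ℂ}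
    (h₀ : |w₀.im| < Real.pi / 2)
    {s : ℂ} (hs : 0 < s.re) (hne : s ≠ Complex.exp w₀) :
    ∫ x : ℝ, cutJump a (Complex.exp (a * w₀)) x *
      (((Real.exp x : ℝ) : ℂ) / (s + ((Real.exp x : ℝ) : ℂ))) =
      2 * Real.pi * Complex.I * regularSymbol a w₀ (Complex.log s) := by
  have hs0 : s ≠ 0 := Complex.ne_zero_of_re_pos hs
  have him : |(Complex.log s).im| < Real.pi / 2 := by
    rw [Complex.log_im]
    exact Complex.abs_arg_lt_pi_div_two_iff.2 (Or.inl hs)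
  have := integral_cutJump_mul ha ha1 h₀ him (fun h => hne (by rw [← h, Complex.exp_log hs0]))
  rwa [Complex.exp_log hs0] at this

/-- Let `s = e^y` tend to `0` in the Stieltjes representation: the factor `e^x/(s + e^x)` tends to
`1` under domination, and the right side tends to the value of the regular symbol at `s = 0`. -/
theorem integral_cutJump {a : ℝ} (ha : 0 < a) (ha1 : a ≤ 1) {w₀ : ℂ}
    (h₀ : |w₀.im| < Real.pi / 2) :
    ∫ x : ℝ, cutJump a (Complex.exp (a * w₀)) x =
      2 * Real.pi * Complex.I * ((1 / a - 1) / Complex.exp (a * w₀)) := by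
  have hpi := Real.pi_pos
  have hi := integrable_cutJump ha ha1 h₀
  have hc := continuous_cutJump ha ha1 h₀
  have hre : Tendsto (fun y : ℝ => (y : ℂ)) atBot (comap Complex.re atBot) :=
    tendsto_comap_iff.2 (tendsto_id.congr fun y => by simp)
  have hR := ((tendsto_regularSymbol_left ha w₀).comp hre).const_mul (2 * Real.pi * Complex.I)
  have hpos : ∀ x y : ℝ, 0 < Real.exp y + Real.exp x := fun x y => by positivity
  have hq : ∀ x y : ℝ, ((Real.exp x : ℝ) : ℂ) / (Complex.exp y + ((Real.exp x : ℝ) : ℂ)) =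
      ((Real.exp x / (Real.exp y + Real.exp x) : ℝ) : ℂ) := by
    intro x y; push_cast; rfl
  have hL : Tendsto (fun y : ℝ => ∫ x : ℝ, cutJump a (Complex.exp (a * w₀)) x *
      (((Real.exp x : ℝ) : ℂ) / (Complex.exp y + ((Real.exp x : ℝ) : ℂ)))) atBot
      (𝓝 (∫ x : ℝ, cutJump a (Complex.exp (a * w₀)) x)) := by
    simp only [hq]
    refine tendsto_integral_filter_of_dominated_convergence
      (fun x => ‖cutJump a (Complex.exp (a * w₀)) x‖) (Eventually.of_forall fun y => ?_)
      (Eventually.of_forall fun y => Eventually.of_forall fun x => ?_) hi.norm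
      (Eventually.of_forall fun x => ?_)
    · refine Continuous.aestronglyMeasurable (hc.mul (Complex.continuous_ofReal.comp ?_))
      exact Continuous.div (by fun_prop) (by fun_prop) fun x => (hpos x y).ne'
    · rw [norm_mul, Complex.norm_real, Real.norm_of_nonneg (by positivity)]
      refine mul_le_of_le_one_right (norm_nonneg _) (div_le_one_of_le₀ ?_ (hpos x y).le)
      linarith [Real.exp_pos y]
    · have h1 : Tendsto (fun y : ℝ => Real.exp x / (Real.exp y + Real.exp x)) atBot (𝓝 1) := by
        have := (tendsto_const_nhds (x := Real.exp x)).div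
          (Real.tendsto_exp_atBot.add_const (Real.exp x)) (by simp)
        rw [zero_add, div_self (Real.exp_pos x).ne'] at this
        exact this
      have h2 := (Complex.continuous_ofReal.tendsto 1).comp h1
      simpa using h2.const_mul (cutJump a (Complex.exp (a * w₀)) x)
  have heq := tendsto_nhds_unique (hL.congr' (by
    filter_upwards [eventually_lt_atBot w₀.re] with y hy
    refine integral_cutJump_mul ha ha1 h₀ (by simpa using by positivity) ?_
    intro h; rw [← h] at hy; simp at hy)) hR
  rw [heq]
  have hac : (a : ℂ) ≠ 0 := by exact_mod_cast ha.ne'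
  have := Complex.exp_ne_zero w₀
  have := Complex.exp_ne_zero (a * w₀)
  field_simp
  ring

theorem integrable_norm_cutJump_mul_exp_div {a : ℝ} (ha : 0 < a) (ha1 : a ≤ 1) {w₀ : ℂ}
    (h₀ : |w₀.im| < Real.pi / 2)
    {σ : ℝ} (hσ : 0 ≤ σ) :
    Integrable fun x : ℝ => ‖cutJump a (Complex.exp (a * w₀)) x * ((Real.exp x : ℝ) : ℂ)‖ /
      (σ + Real.exp x) := by
  have := (integrable_cutJump_mul ha ha1 h₀ (s := (σ : ℂ)) (by simpa using hσ)).norm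
  refine this.congr (Eventually.of_forall fun x => ?_)
  have h1 : 0 < σ + Real.exp x := by positivity
  dsimp only
  rw [← Complex.ofReal_add]
  simp only [norm_mul, norm_div, Complex.norm_real]
  rw [Real.norm_of_nonneg h1.le, mul_div_assoc]

theorem hasLaplace_kernelRemainder {a : ℝ} (ha : 0 < a) (ha1 : a ≤ 1) {w₀ : ℂ}
    (h₀ : |w₀.im| < Real.pi / 2)
    {s : ℂ} (hs : 0 < s.re) (hne : s ≠ Complex.exp w₀) :
    HasLaplace (kernelRemainder a (Complex.exp (a * w₀))) s
      (regularSymbol a w₀ (Complex.log s)) := by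
  have hc := continuous_cutJump ha ha1 h₀
  have hpi : (Real.pi : ℂ) ≠ 0 := by exact_mod_cast Real.pi_ne_zero
  refine ((hasLaplace_expMixture (by fun_prop) hs.le
    (integrable_norm_cutJump_mul_exp_div ha ha1 h₀ hs.le)).const_mul _).congr_value ?_
  simp only [mul_div_assoc]
  rw [integral_cutJump_mul_log ha ha1 h₀ hs hne]
  field_simp [Complex.I_ne_zero]

theorem integrableOn_kernelRemainder {a : ℝ} (ha : 0 < a) (ha1 : a ≤ 1) {w₀ : ℂ}
    (h₀ : |w₀.im| < Real.pi / 2) :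
    IntegrableOn (kernelRemainder a (Complex.exp (a * w₀))) (Ioi 0) := by
  have hc := continuous_cutJump ha ha1 h₀
  have := ((hasLaplace_expMixture (s := 0) (by fun_prop) le_rfl
    (integrable_norm_cutJump_mul_exp_div ha ha1 h₀ le_rfl)).const_mul
      (1 / (2 * Real.pi * Complex.I))).1
  simp only [zero_mul, neg_zero, Complex.exp_zero, one_mul] at this
  exact this

theorem continuousAt_kernelRemainder {a : ℝ} (ha : 0 < a) (ha1 : a ≤ 1) {w₀ : ℂ}
    (h₀ : |w₀.im| < Real.pi / 2)
    {t : ℝ} (ht : 0 < t) :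
    ContinuousAt (kernelRemainder a (Complex.exp (a * w₀))) t := by
  have hc := continuous_cutJump ha ha1 h₀
  refine ContinuousAt.const_mul (continuousAt_expMixture (by fun_prop) (fun c hcpos => ?_) ht) _
  refine ((integrable_cutJump ha ha1 h₀).norm.mul_const (1 / c)).mono'
    (Continuous.aestronglyMeasurable (by fun_prop)) (Eventually.of_forall fun x => ?_)
  -- The bound `y e^(-y) ≤ 1` absorbs the extra factor `e^x`.
  have h1 : Real.exp x * c * Real.exp (-(Real.exp x * c)) ≤ 1 := by
    rw [Real.exp_neg, ← div_eq_mul_inv, div_le_one (Real.exp_pos _)]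
    linarith [Real.add_one_le_exp (Real.exp x * c)]
  rw [norm_mul, norm_norm, norm_mul, Complex.norm_real, Real.norm_of_nonneg (Real.exp_pos _).le,
    Real.norm_of_nonneg (Real.exp_pos _).le, mul_one_div, le_div_iff₀ hcpos]
  calc _ = ‖cutJump a (Complex.exp (a * w₀)) x‖ *
        (Real.exp x * c * Real.exp (-(Real.exp x * c))) := by ring
    _ ≤ _ := mul_le_of_le_one_right (norm_nonneg _) h1

theorem hasLaplace_solutionRemainder {a : ℝ} (ha : 0 < a) (ha1 : a ≤ 1) {w₀ : ℂ}
    (h₀ : |w₀.im| < Real.pi / 2)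
    {s : ℂ} (hs : 0 < s.re) (hne : s ≠ Complex.exp w₀) :
    HasLaplace (solutionRemainder a (Complex.exp (a * w₀))) s
      (1 / s * (1 - 1 / a + Complex.exp (a * w₀) * regularSymbol a w₀ (Complex.log s))) := by
  have hc := continuous_cutJump ha ha1 h₀
  have hi := integrable_cutJump ha ha1 h₀
  have hs0 : s ≠ 0 := Complex.ne_zero_of_re_pos hs
  have hpi : (Real.pi : ℂ) ≠ 0 := by exact_mod_cast Real.pi_ne_zero
  have hint : Integrable fun x : ℝ => ‖cutJump a (Complex.exp (a * w₀)) x‖ /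
      (s.re + Real.exp x) := by
    refine (hi.norm.mul_const (1 / s.re)).mono' ?_ (Eventually.of_forall fun x => ?_)
    · exact Continuous.aestronglyMeasurable (Continuous.div (by fun_prop) (by fun_prop)
        fun x => by positivity)
    · rw [Real.norm_of_nonneg (by positivity), mul_one_div]
      gcongr
      linarith [Real.exp_pos x]
  refine ((hasLaplace_expMixture hc hs.le hint).const_mul _).congr_value ?_
  have hne' : ∀ x : ℝ, s + ((Real.exp x : ℝ) : ℂ) ≠ 0 := fun x => by
    have := re_add_exp_le_norm x s
    have := Real.exp_pos x
    exact norm_pos_iff.1 (by linarith)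
  -- `1/(s + r) = (1/s)(1 - r/(s + r))` reduces the integral to the total jump and the Stieltjes
  -- integral.
  have hsplit : ∀ x : ℝ, cutJump a (Complex.exp (a * w₀)) x / (s + ((Real.exp x : ℝ) : ℂ)) =
      1 / s * (cutJump a (Complex.exp (a * w₀)) x - cutJump a (Complex.exp (a * w₀)) x *
        (((Real.exp x : ℝ) : ℂ) / (s + ((Real.exp x : ℝ) : ℂ)))) := by
    intro x
    have := hne' x
    field_simp
    ring
  simp only [hsplit]
  rw [integral_const_mul, integral_sub hi (integrable_cutJump_mul ha ha1 h₀ hs.le),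
    integral_cutJump_mul_log ha ha1 h₀ hs hne, integral_cutJump ha ha1 h₀]
  have hac : (a : ℂ) ≠ 0 := by exact_mod_cast ha.ne'
  have := Complex.exp_ne_zero (a * w₀)
  have hI := Complex.I_ne_zero
  field_simp
  ring

/-- Splitting of the resolvent kernel into its exponential and its integrable part. -/
theorem mlKernel_eq_exp_add_remainder {a : ℝ} (ha : 0 < a) (ha1 : a ≤ 1) {w₀ : ℂ}
    (h₀ : |w₀.im| < Real.pi / 2)
    {t : ℝ} (ht : 0 < t) :
    mlKernel a a (Complex.exp (a * w₀)) t =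
      Complex.exp w₀ / (a * Complex.exp (a * w₀)) * Complex.exp (Complex.exp w₀ * t) +
        kernelRemainder a (Complex.exp (a * w₀)) t := by
  obtain ⟨σ, hσ, hσ1, hσ2⟩ := exists_abscissa ha (Complex.exp w₀) (Complex.exp (a * w₀))
  refine HasLaplace.eq_of_line (σ := σ)
    (v := fun t : ℝ => Complex.exp w₀ / (a * Complex.exp (a * w₀)) *
      Complex.exp (Complex.exp w₀ * t) + kernelRemainder a (Complex.exp (a * w₀)) t)
    (F := fun s => Complex.exp w₀ / (a * Complex.exp (a * w₀)) * (1 / (s - Complex.exp w₀)) +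
      regularSymbol a w₀ (Complex.log s)) (fun s hs => ?_) (fun s hs => ?_) ht
      (continuousAt_mlKernel ha ha _ ht) ?_
  · subst hs
    have hne : s ≠ Complex.exp w₀ := fun h => by rw [h] at hσ1; exact lt_irrefl _ hσ1
    refine (hasLaplace_mlKernel ha ha hσ hσ2).congr_value ?_
    have h1 := sub_ne_zero.2 (exp_mul_log_ne ha ha1 h₀ hσ hne)
    have h2 : (1 - Complex.exp (a * w₀) * Complex.exp (-(a * Complex.log s))) =
      (Complex.exp (a * Complex.log s) - Complex.exp (a * w₀)) *
        Complex.exp (-(a * Complex.log s)) := by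
      rw [sub_mul, ← Complex.exp_add (a * Complex.log s)]; simp
    rw [h2, regularSymbol, Complex.exp_log (Complex.ne_zero_of_re_pos hσ)]
    have h3 := sub_ne_zero.2 hne
    rw [div_mul_cancel_right₀ (Complex.exp_ne_zero _)]
    ring
  · subst hs
    have hne : s ≠ Complex.exp w₀ := fun h => by rw [h] at hσ1; exact lt_irrefl _ hσ1
    exact ((HasLaplace.exp hσ1).const_mul _).add (hasLaplace_kernelRemainder ha ha1 h₀ hσ hne)
  · have := continuousAt_kernelRemainder ha ha1 h₀ ht
    fun_prop

/-- Splitting of the homogeneous solution into its exponential and its decaying part. -/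
theorem mlKernel_one_eq_exp_add_remainder {a : ℝ} (ha : 0 < a) (ha1 : a ≤ 1) {w₀ : ℂ}
    (h₀ : |w₀.im| < Real.pi / 2)
    {t : ℝ} (ht : 0 < t) :
    mlKernel a 1 (Complex.exp (a * w₀)) t =
      1 / a * Complex.exp (Complex.exp w₀ * t) +
        solutionRemainder a (Complex.exp (a * w₀)) t := by
  obtain ⟨σ, hσ, hσ1, hσ2⟩ := exists_abscissa ha (Complex.exp w₀) (Complex.exp (a * w₀))
  refine HasLaplace.eq_of_line (σ := σ)
    (v := fun t : ℝ => 1 / a * Complex.exp (Complex.exp w₀ * t) +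
      solutionRemainder a (Complex.exp (a * w₀)) t)
    (F := fun s => 1 / a * (1 / (s - Complex.exp w₀)) +
      1 / s * (1 - 1 / a + Complex.exp (a * w₀) * regularSymbol a w₀ (Complex.log s)))
      (fun s hs => ?_) (fun s hs => ?_) ht (continuousAt_mlKernel ha one_pos _ ht) ?_
  · subst hs
    have hne : s ≠ Complex.exp w₀ := fun h => by rw [h] at hσ1; exact lt_irrefl _ hσ1
    refine (hasLaplace_mlKernel ha one_pos hσ hσ2).congr_value ?_
    have h1 := sub_ne_zero.2 (exp_mul_log_ne ha ha1 h₀ hσ hne)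
    have hs0 := Complex.ne_zero_of_re_pos hσ
    have h3 := sub_ne_zero.2 hne
    have h4 := Complex.exp_ne_zero (a * Complex.log s)
    have h5 := Complex.exp_ne_zero (a * w₀)
    have hac : (a : ℂ) ≠ 0 := by exact_mod_cast ha.ne'
    rw [regularSymbol, Complex.ofReal_one, one_mul, Complex.exp_neg, Complex.exp_neg,
      Complex.exp_log hs0]
    have h2 : (1 - Complex.exp (a * w₀) * (Complex.exp (a * Complex.log s))⁻¹) =
      (Complex.exp (a * Complex.log s) - Complex.exp (a * w₀)) /
        Complex.exp (a * Complex.log s) := by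
      field_simp
    rw [h2]
    field_simp
    ring
  · subst hs
    have hne : s ≠ Complex.exp w₀ := fun h => by rw [h] at hσ1; exact lt_irrefl _ hσ1
    exact ((HasLaplace.exp hσ1).const_mul _).add (hasLaplace_solutionRemainder ha ha1 h₀ hσ hne)
  · have hc := continuous_cutJump ha ha1 h₀
    have : ContinuousAt (solutionRemainder a (Complex.exp (a * w₀))) t := by
      refine ContinuousAt.const_mul (continuousAt_expMixture hc (fun c hcpos => ?_) ht) _
      refine (integrable_cutJump ha ha1 h₀).norm.bdd_mul (c := 1)
        (Continuous.aestronglyMeasurable (by fun_prop)) (Eventually.of_forall fun x => ?_)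
      rw [Real.norm_of_nonneg (Real.exp_pos _).le, Real.exp_le_one_iff]
      have := Real.exp_pos x
      nlinarith
    fun_prop

/-! ### The Caputo equation on the Laplace side. -/

theorem norm_exp_mul_log (a : ℝ) {z : ℂ} (hz : z ≠ 0) :
    ‖Complex.exp (a * Complex.log z)‖ = ‖z‖ ^ a := by
  rw [Complex.norm_exp, Real.rpow_def_of_pos (norm_pos_iff.2 hz)]
  simp [Complex.log_re, mul_comm]

theorem exp_mul_log_sub_ne_zero {a : ℝ} (ha : 0 < a) {lam s : ℂ} (hs : 0 < s.re)
    (hlam : ‖lam‖ < s.re ^ a) : Complex.exp (a * Complex.log s) - lam ≠ 0 := by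
  intro h
  have h1 := norm_exp_mul_log a (Complex.ne_zero_of_re_pos hs)
  rw [sub_eq_zero.1 h] at h1
  have h2 : s.re ^ a ≤ ‖s‖ ^ a := by gcongr; exact Complex.re_le_norm s
  linarith

theorem variationOfConstants_eq (a : ℝ) (lam : ℂ) (f : ℝ → ℝ) (x₀ : ℂ) :
    variationOfConstants a lam f x₀ = fun t =>
      mlKernel a 1 lam t * x₀ + halfConv (mlKernel a a lam) (fun τ => ((f τ : ℝ) : ℂ)) t := by
  ext t
  simp only [variationOfConstants, mlKernel, sub_self, Real.rpow_zero, Complex.ofReal_one, one_mul,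
    halfConv, convolutionIntegrand]

theorem variationOfConstants_zero {a : ℝ} (ha : 0 < a) (lam : ℂ) (f : ℝ → ℝ) (x₀ : ℂ) :
    variationOfConstants a lam f x₀ 0 = x₀ := by
  simp [variationOfConstants, Real.zero_rpow ha.ne', mittagLeffler_zero_right]

theorem integrableOn_mlKernel {a : ℝ} (ha : 0 < a) (lam : ℂ) (T : ℝ) :
    IntegrableOn (mlKernel a a lam) (Ioc 0 T) := by
  obtain ⟨σ, hσ, -, hσ2⟩ := exists_abscissa ha 0 lam
  exact (hasLaplace_mlKernel ha ha (s := (σ : ℂ)) (by simpa using hσ)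
    (by simpa using hσ2)).integrableOn_Ioc T

theorem continuousOn_variationOfConstants {a : ℝ} (ha : 0 < a) (lam : ℂ) {f : ℝ → ℝ}
    (hf : ContinuousOn f (Ici 0)) (x₀ : ℂ) :
    ContinuousOn (variationOfConstants a lam f x₀) (Ici 0) := by
  have hf' : ContinuousOn (fun τ => ((f τ : ℝ) : ℂ)) (Ici 0) :=
    Complex.continuous_ofReal.comp_continuousOn hf
  have h1 := continuousOn_halfConv (integrableOn_mlKernel ha lam) hf'
  have h2 : Continuous fun t : ℝ => t ^ a := Real.continuous_rpow_const ha.le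
  have h3 := continuous_mittagLeffler ha one_pos
  have h4 : ContinuousOn (fun t : ℝ => mittagLeffler a 1 (lam * ((t ^ a : ℝ) : ℂ)) * x₀ +
      halfConv (mlKernel a a lam) (fun τ => ((f τ : ℝ) : ℂ)) t) (Ici 0) :=
    ContinuousOn.add (Continuous.continuousOn (by fun_prop)) h1
  exact h4

theorem hasLaplace_variationOfConstants {a : ℝ} (ha : 0 < a) {lam s F : ℂ} {f : ℝ → ℝ}
    (hs : 0 < s.re) (hlam : ‖lam‖ < s.re ^ a)
    (hF : HasLaplace (fun τ => ((f τ : ℝ) : ℂ)) s F) (x₀ : ℂ) :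
    HasLaplace (variationOfConstants a lam f x₀) s
      ((Complex.exp (a * Complex.log s) * x₀ / s + F) /
        (Complex.exp (a * Complex.log s) - lam)) := by
  rw [variationOfConstants_eq]
  refine (((hasLaplace_mlKernel ha one_pos hs hlam).mul_const x₀).add
    ((hasLaplace_mlKernel ha ha hs hlam).conv hF)).congr_value ?_
  have hs0 := Complex.ne_zero_of_re_pos hs
  have h1 := exp_mul_log_sub_ne_zero ha hs hlam
  have h4 := Complex.exp_ne_zero (a * Complex.log s)
  rw [Complex.ofReal_one, one_mul, Complex.exp_neg, Complex.exp_neg, Complex.exp_log hs0]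
  have h2 : (1 - lam * (Complex.exp (a * Complex.log s))⁻¹) =
    (Complex.exp (a * Complex.log s) - lam) / Complex.exp (a * Complex.log s) := by
    field_simp
  rw [h2]
  field_simp

theorem rlIntegral_eq_halfConv (β : ℝ) (x : ℝ → ℂ) :
    rlIntegral β x =
      halfConv (fun t => ((t ^ (β - 1) : ℝ) : ℂ) / ((Real.Gamma β : ℝ) : ℂ)) x := by
  ext t
  rw [rlIntegral, halfConv, ← intervalIntegral.integral_const_mul]
  refine intervalIntegral.integral_congr fun τ _ => ?_
  push_cast
  ring

theorem hasLaplace_rlIntegral {β : ℝ} (hβ : 0 < β) {x : ℝ → ℂ} {s X : ℂ} (hs : 0 < s.re)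
    (hx : HasLaplace x s X) :
    HasLaplace (rlIntegral β x) s (Complex.exp (-(β * Complex.log s)) * X) := by
  rw [rlIntegral_eq_halfConv]
  exact (hasLaplace_rpow hβ hs).conv hx

theorem continuousOn_rlIntegral {β : ℝ} (hβ : 0 < β) {x : ℝ → ℂ} (hx : ContinuousOn x (Ici 0)) :
    ContinuousOn (rlIntegral β x) (Ici 0) := by
  rw [rlIntegral_eq_halfConv]
  exact continuousOn_halfConv
    (hasLaplace_rpow hβ (s := 1) (by simp)).integrableOn_Ioc hx

theorem halfConv_one (x : ℝ → ℂ) : halfConv (fun _ => 1) x = fun t => ∫ τ in (0 : ℝ)..t, x τ := by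
  ext t
  simp [halfConv]

theorem continuousOn_primitive_Ici {x : ℝ → ℂ} (hx : ContinuousOn x (Ici 0)) :
    ContinuousOn (fun t => ∫ τ in (0 : ℝ)..t, x τ) (Ici 0) := by
  rw [← halfConv_one]
  exact continuousOn_halfConv (fun T => by simp) hx

theorem hasLaplace_primitive {x : ℝ → ℂ} {s X : ℂ} (hs : 0 < s.re) (hx : HasLaplace x s X) :
    HasLaplace (fun t => ∫ τ in (0 : ℝ)..t, x τ) s (1 / s * X) := by
  rw [← halfConv_one]
  exact (HasLaplace.const 1 hs).conv hx

theorem exp_neg_one_sub_mul_log (a : ℝ) {s : ℂ} (hs : s ≠ 0) :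
    Complex.exp (-(((1 - a : ℝ) : ℂ) * Complex.log s)) = Complex.exp (a * Complex.log s) / s := by
  rw [show -(((1 - a : ℝ) : ℂ) * Complex.log s) = a * Complex.log s - Complex.log s by
    push_cast; ring, Complex.exp_sub, Complex.exp_log hs]

/-- Both sides of the integrated equation are continuous with equal transforms, hence equal for `t >
0`. The right side is the primitive of a continuous function, so differentiability of the fractional
integral comes for free. -/
theorem isCaputoSolution_variationOfConstants {a : ℝ} (ha : 0 < a) (ha1 : a < 1) (lam : ℂ)
    {f : ℝ → ℝ} (hf : ContinuousOn f (Ici 0)) (hfb : BoundedOnHalfLine f) (x₀ : ℂ) :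
    IsCaputoSolution a lam f (variationOfConstants a lam f x₀) := by
  have hf' : ContinuousOn (fun τ => ((f τ : ℝ) : ℂ)) (Ici 0) :=
    Complex.continuous_ofReal.comp_continuousOn hf
  have hfb' : BoundedOnHalfLine (fun τ => ((f τ : ℝ) : ℂ)) := by
    obtain ⟨C, hC⟩ := hfb
    exact ⟨C, fun t ht => by simpa using hC t ht⟩
  have hxc := continuousOn_variationOfConstants ha lam hf x₀
  obtain ⟨σ, hσ, -, hσ2⟩ := exists_abscissa ha 0 lam
  set x := variationOfConstants a lam f x₀ with hx
  have hx0 : x 0 = x₀ := variationOfConstants_zero ha lam f x₀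
  have hyc : ContinuousOn (fun t => lam * x t + ((f t : ℝ) : ℂ)) (Ici 0) := by fun_prop
  have hdc : ContinuousOn (fun t => x t - x 0) (Ici 0) := by fun_prop
  have key : ∀ t : ℝ, 0 < t → rlIntegral (1 - a) (fun τ => x τ - x 0) t =
      ∫ τ in (0 : ℝ)..t, (lam * x τ + ((f τ : ℝ) : ℂ)) := by
    intro t ht
    refine HasLaplace.eq_of_line (σ := σ)
      (v := fun t => ∫ τ in (0 : ℝ)..t, (lam * x τ + ((f τ : ℝ) : ℂ)))
      (F := fun s => 1 / s * (lam * ((Complex.exp (a * Complex.log s) * x₀ / s +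
        ∫ t in Ioi (0 : ℝ), Complex.exp (-(s * t)) * ((f t : ℝ) : ℂ)) /
        (Complex.exp (a * Complex.log s) - lam)) +
        ∫ t in Ioi (0 : ℝ), Complex.exp (-(s * t)) * ((f t : ℝ) : ℂ)))
      (fun s hs => ?_) (fun s hs => ?_) ht
      ((continuousOn_rlIntegral (by linarith) hdc).continuousAt (Ici_mem_nhds ht))
      ((continuousOn_primitive_Ici hyc).continuousAt (Ici_mem_nhds ht))
    · subst hs
      have hF := HasLaplace.of_bounded hσ hf' hfb'
      have hX := hasLaplace_variationOfConstants ha hσ hσ2 hF x₀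
      rw [hx0]
      refine (hasLaplace_rlIntegral (by linarith) hσ
        (hX.sub (HasLaplace.const x₀ hσ))).congr_value ?_
      have hs0 := Complex.ne_zero_of_re_pos hσ
      rw [exp_neg_one_sub_mul_log a hs0]
      have h1 := exp_mul_log_sub_ne_zero ha hσ hσ2
      field_simp
      ring
    · subst hs
      have hF := HasLaplace.of_bounded hσ hf' hfb'
      have hX := hasLaplace_variationOfConstants ha hσ hσ2 hF x₀
      exact hasLaplace_primitive hσ ((hX.const_mul lam).add hF)
  refine ⟨hxc, fun t ht => ?_⟩
  have hFTC : HasDerivAt (fun t => ∫ τ in (0 : ℝ)..t, (lam * x τ + ((f τ : ℝ) : ℂ)))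
      (lam * x t + ((f t : ℝ) : ℂ)) t := by
    refine intervalIntegral.integral_hasDerivAt_right ?_ ?_ (hyc.continuousAt (Ici_mem_nhds ht))
    · refine ContinuousOn.intervalIntegrable (hyc.mono fun τ hτ => ?_)
      rw [uIcc_of_le ht.le] at hτ
      exact hτ.1
    · exact (hyc.mono Ioi_subset_Ici_self).stronglyMeasurableAtFilter isOpen_Ioi t ht
  refine hFTC.congr_of_eventuallyEq ?_
  filter_upwards [Ioi_mem_nhds ht] with τ hτ using key τ hτ

/-- The algebraic form of the equation for the Laplace transform of a bounded solution. -/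
theorem laplace_equation_of_isCaputoSolution {a : ℝ} (ha1 : a < 1) {lam : ℂ}
    {f : ℝ → ℝ} {x : ℝ → ℂ} (hf : ContinuousOn f (Ici 0)) (hx : IsCaputoSolution a lam f x)
    {s X F : ℂ} (hs : 0 < s.re) (hX : HasLaplace x s X)
    (hF : HasLaplace (fun τ => ((f τ : ℝ) : ℂ)) s F) :
    (Complex.exp (a * Complex.log s) - lam) * X =
      Complex.exp (a * Complex.log s) * x 0 / s + F := by
  have hf' : ContinuousOn (fun τ => ((f τ : ℝ) : ℂ)) (Ici 0) :=
    Complex.continuous_ofReal.comp_continuousOn hf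
  have hxc := hx.1
  have hyc : ContinuousOn (fun t => lam * x t + ((f t : ℝ) : ℂ)) (Ici 0) := by fun_prop
  have hdc : ContinuousOn (fun t => x t - x 0) (Ici 0) := by fun_prop
  have key : ∀ t : ℝ, 0 < t → rlIntegral (1 - a) (fun τ => x τ - x 0) t =
      ∫ τ in (0 : ℝ)..t, (lam * x τ + ((f τ : ℝ) : ℂ)) := by
    intro t ht
    -- The derivative is known only for `t > 0`; continuity of the fractional integral at `0`, where
    -- it vanishes, permits integration from `0`.
    have := intervalIntegral.integral_eq_sub_of_hasDerivAt_of_le ht.le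
      ((continuousOn_rlIntegral (β := 1 - a) (by linarith) hdc).mono Icc_subset_Ici_self)
      (fun τ hτ => hx.2 τ hτ.1)
      (ContinuousOn.intervalIntegrable (hyc.mono fun τ hτ => by
        rw [uIcc_of_le ht.le] at hτ
        exact hτ.1))
    rw [this]
    simp [rlIntegral]
  have h1 := (hasLaplace_rlIntegral (β := 1 - a) (by linarith) hs
    (hX.sub (HasLaplace.const (x 0) hs))).congr key
  have h2 := h1.unique (hasLaplace_primitive hs ((hX.const_mul lam).add hF))
  have hs0 := Complex.ne_zero_of_re_pos hs
  rw [exp_neg_one_sub_mul_log a hs0] at h2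
  field_simp at h2 ⊢
  linear_combination h2

/-! ### Bounds and decay of convolutions and tails; cancellation of the growing terms. -/

/-- A domain independent of `t` allows dominated convergence; `max 0` keeps the argument of `v` in
the half-line, where its bound holds. -/
theorem halfConv_eq_setIntegral (u v : ℝ → ℂ) {t : ℝ} (ht : 0 ≤ t) :
    halfConv u v t =
      ∫ τ in Ioi (0 : ℝ), (Iic t).indicator (fun τ => u τ * v (max 0 (t - τ))) τ := by
  rw [halfConv_eq, intervalIntegral.integral_of_le ht, setIntegral_indicator measurableSet_Iic,
    Ioi_inter_Iic]
  refine setIntegral_congr_fun measurableSet_Ioc fun τ hτ => ?_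
  simp only [max_eq_right (sub_nonneg.2 hτ.2)]

theorem norm_indicator_mul_le {u v : ℝ → ℂ} {C : ℝ} (hC : ∀ t, 0 ≤ t → ‖v t‖ ≤ C) (t τ : ℝ) :
    ‖(Iic t).indicator (fun τ => u τ * v (max 0 (t - τ))) τ‖ ≤ ‖u τ‖ * C := by
  refine (norm_indicator_le_norm_self _ _).trans ?_
  rw [norm_mul]
  gcongr
  exact hC _ (le_max_left _ _)

theorem norm_halfConv_le {u v : ℝ → ℂ} (hu : IntegrableOn u (Ioi 0)) {C : ℝ}
    (hC : ∀ t, 0 ≤ t → ‖v t‖ ≤ C) {t : ℝ} (ht : 0 ≤ t) :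
    ‖halfConv u v t‖ ≤ ∫ τ in Ioi (0 : ℝ), ‖u τ‖ * C := by
  rw [halfConv_eq_setIntegral u v ht]
  exact norm_integral_le_of_norm_le (hu.norm.mul_const C)
    (Eventually.of_forall fun τ => norm_indicator_mul_le hC t τ)

theorem tendsto_halfConv {u v : ℝ → ℂ} (hu : IntegrableOn u (Ioi 0)) (hv : ContinuousOn v (Ici 0))
    (hb : BoundedOnHalfLine v) (h : Tendsto v atTop (𝓝 0)) :
    Tendsto (halfConv u v) atTop (𝓝 0) := by
  obtain ⟨C, hC⟩ := hb
  have hwc : Continuous fun t => v (max 0 t) :=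
    hv.comp_continuous (by fun_prop) (fun t => mem_Ici.2 (le_max_left 0 t))
  have h0 : Tendsto (fun t => ∫ τ in Ioi (0 : ℝ),
      (Iic t).indicator (fun τ => u τ * v (max 0 (t - τ))) τ) atTop
      (𝓝 (∫ _ in Ioi (0 : ℝ), (0 : ℂ))) := by
    refine tendsto_integral_filter_of_dominated_convergence (fun τ => ‖u τ‖ * C)
      (Eventually.of_forall fun t => ?_)
      (Eventually.of_forall fun t => Eventually.of_forall fun τ => norm_indicator_mul_le hC t τ)
      (hu.norm.mul_const C) (Eventually.of_forall fun τ => ?_)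
    · have hw : Continuous fun τ => v (max 0 (t - τ)) :=
        hwc.comp (by fun_prop : Continuous fun τ => t - τ)
      exact (hu.1.mul hw.aestronglyMeasurable).indicator measurableSet_Iic
    · have h1 : Tendsto (fun t => u τ * v (t - τ)) atTop (𝓝 0) := by
        simpa [sub_eq_add_neg] using
          (h.comp (tendsto_atTop_add_const_right _ (-τ) tendsto_id)).const_mul (u τ)
      refine h1.congr' ?_
      filter_upwards [eventually_ge_atTop τ] with t ht
      rw [indicator_of_mem (mem_Iic.2 ht), max_eq_right (by linarith)]
  simp only [integral_zero] at h0
  refine h0.congr' ?_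
  filter_upwards [eventually_ge_atTop 0] with t ht using (halfConv_eq_setIntegral u v ht).symm

/-- Translation by `t` absorbs the growing factor `e^(mt)` into the tail, leaving an integral
uniformly bounded in `t` when `Re m > 0` and `v` is bounded. -/
theorem exp_mul_setIntegral_Ioi (m : ℂ) (v : ℝ → ℂ) (t : ℝ) :
    Complex.exp (m * t) * ∫ τ in Ioi t, Complex.exp (-(m * τ)) * v τ =
      ∫ τ in Ioi (0 : ℝ), Complex.exp (-(m * τ)) * v (τ + t) := by
  rw [← integral_const_mul]
  have h := (measurePreserving_add_right volume t).setIntegral_preimage_emb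
    (measurableEmbedding_addRight t)
    (fun τ : ℝ => Complex.exp (m * t) * (Complex.exp (-(m * τ)) * v τ)) (Ioi t)
  rw [← h]
  have hs : (fun x => x + t) ⁻¹' Ioi t = Ioi (0 : ℝ) := by ext x; simp
  rw [hs]
  congr 1
  ext τ
  rw [← mul_assoc, ← Complex.exp_add]
  congr 2
  push_cast
  ring

theorem norm_tailIntegral_le {m : ℂ} (hm : 0 < m.re) {v : ℝ → ℂ} {C : ℝ}
    (hC : ∀ t, 0 ≤ t → ‖v t‖ ≤ C) {t : ℝ} (ht : 0 ≤ t) :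
    ‖∫ τ in Ioi (0 : ℝ), Complex.exp (-(m * τ)) * v (τ + t)‖ ≤
      ∫ τ in Ioi (0 : ℝ), ‖Complex.exp (-(m * τ))‖ * C := by
  have hi : IntegrableOn (fun τ : ℝ => Complex.exp (-(m * τ))) (Ioi 0) := by
    simpa only [neg_mul] using integrableOn_exp_mul_complex_Ioi (a := -m) (by simpa using hm) 0
  refine norm_integral_le_of_norm_le (hi.norm.mul_const C) ?_
  filter_upwards [ae_restrict_mem measurableSet_Ioi] with τ hτ
  rw [norm_mul]
  gcongr
  exact hC _ (add_nonneg (le_of_lt hτ) ht)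

theorem tendsto_tailIntegral {m : ℂ} (hm : 0 < m.re) {v : ℝ → ℂ} (hv : ContinuousOn v (Ici 0))
    (hb : BoundedOnHalfLine v) (h : Tendsto v atTop (𝓝 0)) :
    Tendsto (fun t => ∫ τ in Ioi (0 : ℝ), Complex.exp (-(m * τ)) * v (τ + t)) atTop (𝓝 0) := by
  obtain ⟨C, hC⟩ := hb
  have hi : IntegrableOn (fun τ : ℝ => Complex.exp (-(m * τ))) (Ioi 0) := by
    simpa only [neg_mul] using integrableOn_exp_mul_complex_Ioi (a := -m) (by simpa using hm) 0
  have h0 : Tendsto (fun t => ∫ τ in Ioi (0 : ℝ), Complex.exp (-(m * τ)) * v (τ + t)) atTop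
      (𝓝 (∫ _ in Ioi (0 : ℝ), (0 : ℂ))) := by
    refine tendsto_integral_filter_of_dominated_convergence
      (fun τ => ‖Complex.exp (-(m * τ))‖ * C) ?_ ?_ (hi.norm.mul_const C)
      (Eventually.of_forall fun τ => ?_)
    · filter_upwards [eventually_ge_atTop 0] with t ht
      refine hi.1.mul (ContinuousOn.aestronglyMeasurable ?_ measurableSet_Ioi)
      exact hv.comp (by fun_prop) fun τ hτ => mem_Ici.2 (add_nonneg (le_of_lt hτ) ht)
    · filter_upwards [eventually_ge_atTop 0] with t ht
      filter_upwards [ae_restrict_mem measurableSet_Ioi] with τ hτ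
      rw [norm_mul]
      gcongr
      exact hC _ (add_nonneg (le_of_lt hτ) ht)
    · simpa using (h.comp (tendsto_atTop_add_const_left _ τ tendsto_id)).const_mul
        (Complex.exp (-(m * τ)))
  simpa using h0

/-- For the distinguished initial value the exponentially growing parts of the two terms of the
variation of constants formula cancel. -/
theorem variationOfConstants_eq_remainders {a : ℝ} (ha : 0 < a) (ha1 : a ≤ 1) {w₀ : ℂ}
    (h₀ : |w₀.im| < Real.pi / 2) {f : ℝ → ℝ} (hf : ContinuousOn f (Ici 0)) {F x₀ : ℂ}
    (hF : HasLaplace (fun τ => ((f τ : ℝ) : ℂ)) (Complex.exp w₀) F)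
    (hx₀ : x₀ = -(Complex.exp w₀ / Complex.exp (a * w₀)) * F) {t : ℝ} (ht : 0 < t) :
    variationOfConstants a (Complex.exp (a * w₀)) f x₀ t =
      solutionRemainder a (Complex.exp (a * w₀)) t * x₀ +
      halfConv (kernelRemainder a (Complex.exp (a * w₀))) (fun τ => ((f τ : ℝ) : ℂ)) t -
      Complex.exp w₀ / (a * Complex.exp (a * w₀)) *
        ∫ τ in Ioi (0 : ℝ), Complex.exp (-(Complex.exp w₀ * τ)) * ((f (τ + t) : ℝ) : ℂ) := by
  have hf' : ContinuousOn (fun τ => ((f τ : ℝ) : ℂ)) (Ici 0) :=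
    Complex.continuous_ofReal.comp_continuousOn hf
  set m := Complex.exp w₀ with hm
  set lam := Complex.exp (a * w₀) with hlam
  have hac : (a : ℂ) ≠ 0 := by exact_mod_cast ha.ne'
  have hlam0 : lam ≠ 0 := Complex.exp_ne_zero _
  set v : ℝ → ℂ := fun τ => ((f τ : ℝ) : ℂ) with hv
  have hfI : ContinuousOn v (uIcc 0 t) := hf'.mono fun τ hτ => by
    rw [uIcc_of_le ht.le] at hτ
    exact hτ.1
  have hr : IntervalIntegrable (fun τ => kernelRemainder a lam (t - τ) * v τ) volume 0 t := by
    refine IntervalIntegrable.mul_continuousOn ?_ hfI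
    have := ((intervalIntegrable_iff_integrableOn_Ioc_of_le ht.le).2
      ((integrableOn_kernelRemainder ha ha1 h₀).mono_set Ioc_subset_Ioi_self)).comp_sub_left
        (a := 0) (b := t) (c := t)
    simpa using this.symm
  have he : IntervalIntegrable (fun τ : ℝ => m / (a * lam) * Complex.exp (m * t) *
      (Complex.exp (-(m * τ)) * v τ)) volume 0 t :=
    ContinuousOn.intervalIntegrable (by fun_prop)
  have hconv : halfConv (mlKernel a a lam) v t =
      m / (a * lam) * Complex.exp (m * t) * (∫ τ in (0 : ℝ)..t, Complex.exp (-(m * τ)) * v τ) +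
        halfConv (kernelRemainder a lam) v t := by
    rw [halfConv, halfConv, ← intervalIntegral.integral_const_mul,
      ← intervalIntegral.integral_add he hr]
    refine intervalIntegral.integral_congr_ae ?_
    -- The splitting of the kernel holds only for `t - τ > 0`, so the endpoint is discarded as a
    -- null set.
    have hne : ∀ᵐ τ : ℝ, τ ≠ t := by simp [ae_iff]
    filter_upwards [hne] with τ hτt hτ
    rw [uIoc_of_le ht.le] at hτ
    rw [mlKernel_eq_exp_add_remainder ha ha1 h₀ (sub_pos.2 (lt_of_le_of_ne hτ.2 hτt)),
      show Complex.exp (m * ((t - τ : ℝ) : ℂ)) = Complex.exp (m * t) * Complex.exp (-(m * τ)) by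
        rw [← Complex.exp_add]; congr 1; push_cast; ring]
    ring
  have hsplit : (∫ τ in (0 : ℝ)..t, Complex.exp (-(m * τ)) * v τ) +
      ∫ τ in Ioi t, Complex.exp (-(m * τ)) * v τ = F := by
    rw [← hF.2]
    exact intervalIntegral.integral_interval_add_Ioi hF.1 (hF.1.mono_set (Ioi_subset_Ioi ht.le))
  rw [variationOfConstants_eq]
  simp only
  rw [hconv, mlKernel_one_eq_exp_add_remainder ha ha1 h₀ ht, ← exp_mul_setIntegral_Ioi m v t]
  -- The coefficient of `e^(mt)` in the homogeneous part is minus the residue times the full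
  -- transform `F`; subtracting the integral up to `t` leaves the tail.
  have hx₁ : 1 / (a : ℂ) * x₀ = -(m / (a * lam)) * F := by
    rw [hx₀]; field_simp
  rw [← hsplit] at hx₁
  linear_combination Complex.exp (m * t) * hx₁

end

/-! ### Assembly of the theorem. -/

theorem proposition2 (α : ℝ) (hα0 : 0 < α) (hα1 : α < 1)
    (lam : ℂ) (hlam : lam ∈ unstableSector α)
    (f : ℝ → ℝ) (hfc : ContinuousOn f (Ici 0)) (hfb : BoundedOnHalfLine f) :
    -- the integrals in the formula converge absolutely
    IntegrableOn (laplaceIntegrand α lam f) (Ioi 0) ∧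
    (∀ t : ℝ, 0 ≤ t → IntervalIntegrable (convolutionIntegrand α lam f t) volume 0 t) ∧
    -- the formula gives a bounded solution, with the stated initial value
    IsCaputoSolution α lam f (variationOfConstants α lam f (boundedInitialValue α lam f)) ∧
    BoundedOnHalfLine (variationOfConstants α lam f (boundedInitialValue α lam f)) ∧
    variationOfConstants α lam f (boundedInitialValue α lam f) 0 = boundedInitialValue α lam f ∧
    -- every bounded solution, whatever its initial value, is this one
    (∀ x : ℝ → ℂ, IsCaputoSolution α lam f x → BoundedOnHalfLine x →
      ∀ t : ℝ, 0 ≤ t → x t = variationOfConstants α lam f (boundedInitialValue α lam f) t) ∧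
    -- it decays if the forcing term decays
    (Tendsto f atTop (𝓝 0) →
      Tendsto (variationOfConstants α lam f (boundedInitialValue α lam f)) atTop (𝓝 0)) := by
  obtain ⟨hlam0, harg⟩ := hlam
  have hac : (α : ℂ) ≠ 0 := by exact_mod_cast hα0.ne'
  have hf' : ContinuousOn (fun τ => ((f τ : ℝ) : ℂ)) (Ici 0) :=
    Complex.continuous_ofReal.comp_continuousOn hfc
  have hfb' : BoundedOnHalfLine (fun τ => ((f τ : ℝ) : ℂ)) := by
    obtain ⟨C, hC⟩ := hfb
    exact ⟨C, fun t ht => by simpa using hC t ht⟩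
  set w₀ : ℂ := Complex.log lam * ((1 / α : ℝ) : ℂ) with hw₀
  have h₀ : |w₀.im| < Real.pi / 2 := by
    rw [hw₀, Complex.im_mul_ofReal, Complex.log_im, abs_mul,
      abs_of_pos (one_div_pos.2 hα0), mul_one_div, div_lt_iff₀ hα0]
    linarith
  have hmu : lam ^ ((1 / α : ℝ) : ℂ) = Complex.exp w₀ := by
    rw [Complex.cpow_def_of_ne_zero hlam0]
  have hlamexp : lam = Complex.exp (α * w₀) := by
    rw [hw₀]
    push_cast
    rw [show (α : ℂ) * (Complex.log lam * (1 / (α : ℂ))) = Complex.log lam by field_simp,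
      Complex.exp_log hlam0]
  have hpow : lam ^ ((1 / α - 1 : ℝ) : ℂ) = Complex.exp w₀ / Complex.exp (α * w₀) := by
    rw [← hlamexp, Complex.cpow_def_of_ne_zero hlam0, Complex.ofReal_sub, mul_sub, Complex.exp_sub,
      Complex.ofReal_one, mul_one, Complex.exp_log hlam0]
  have hmre : 0 < (Complex.exp w₀).re := by
    rw [Complex.exp_re]
    have := Real.cos_pos_of_mem_Ioo (abs_lt.1 h₀ |> fun h => ⟨by linarith [h.1], h.2⟩)
    positivity
  have hlap : laplaceIntegrand α lam f =
      fun τ : ℝ => Complex.exp (-(Complex.exp w₀ * τ)) * ((f τ : ℝ) : ℂ) := by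
    ext τ
    rw [laplaceIntegrand, hmu, neg_mul]
  set F : ℂ := ∫ τ in Ioi (0 : ℝ), Complex.exp (-(Complex.exp w₀ * τ)) * ((f τ : ℝ) : ℂ) with hFdef
  have hF : HasLaplace (fun τ => ((f τ : ℝ) : ℂ)) (Complex.exp w₀) F :=
    HasLaplace.of_bounded hmre hf' hfb'
  have hx₀ : boundedInitialValue α lam f = -(Complex.exp w₀ / Complex.exp (α * w₀)) * F := by
    rw [boundedInitialValue, hpow, hlap]
  have hrem : ∀ t : ℝ, 0 < t → variationOfConstants α lam f (boundedInitialValue α lam f) t =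
      solutionRemainder α lam t * boundedInitialValue α lam f +
      halfConv (kernelRemainder α lam) (fun τ => ((f τ : ℝ) : ℂ)) t -
      Complex.exp w₀ / (α * lam) *
        ∫ τ in Ioi (0 : ℝ), Complex.exp (-(Complex.exp w₀ * τ)) * ((f (τ + t) : ℝ) : ℂ) := by
    intro t ht
    have := variationOfConstants_eq_remainders hα0 hα1.le h₀ hfc hF hx₀ ht
    rwa [← hlamexp] at this
  have hri : IntegrableOn (kernelRemainder α lam) (Ioi 0) := by
    rw [hlamexp]; exact integrableOn_kernelRemainder hα0 hα1.le h₀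
  have hDi : Integrable (cutJump α lam) := by
    rw [hlamexp]; exact integrable_cutJump hα0 hα1.le h₀
  have hDc : Continuous (cutJump α lam) := by
    rw [hlamexp]; exact continuous_cutJump hα0 hα1.le h₀
  have h_zero := variationOfConstants_zero hα0 lam f (boundedInitialValue α lam f)
  refine ⟨?_, ?_, isCaputoSolution_variationOfConstants hα0 hα1 lam hfc hfb _, ?_, h_zero, ?_, ?_⟩
  · rw [hlap]; exact hF.1
  · intro t ht
    have h1 := ((intervalIntegrable_iff_integrableOn_Ioc_of_le ht).2
      (integrableOn_mlKernel hα0 lam t)).comp_sub_left (a := 0) (b := t) (c := t)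
    have h2 : IntervalIntegrable (fun τ => mlKernel α α lam (t - τ)) volume 0 t := by
      simpa using h1.symm
    refine h2.mul_continuousOn (hf'.mono fun τ hτ => ?_)
    rw [uIcc_of_le ht] at hτ
    exact hτ.1
  · obtain ⟨C, hC⟩ := hfb'
    refine ⟨max ‖boundedInitialValue α lam f‖
      (‖-(lam / (2 * Real.pi * Complex.I))‖ * (∫ x, ‖cutJump α lam x‖) *
        ‖boundedInitialValue α lam f‖ +
        (∫ τ in Ioi (0 : ℝ), ‖kernelRemainder α lam τ‖ * C) +
        ‖Complex.exp w₀ / (α * lam)‖ *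
          ∫ τ in Ioi (0 : ℝ), ‖Complex.exp (-(Complex.exp w₀ * τ))‖ * C), fun t ht => ?_⟩
    rcases ht.eq_or_lt with h | h
    · rw [← h, h_zero]
      exact le_max_left _ _
    · refine le_trans ?_ (le_max_right _ _)
      rw [hrem t h]
      refine (norm_sub_le _ _).trans (_root_.add_le_add ?_ ?_)
      on_goal 1 => refine (norm_add_le _ _).trans (_root_.add_le_add ?_ ?_)
      · rw [norm_mul, solutionRemainder, norm_mul]
        gcongr
        exact norm_expMixture_le hDi ht
      · exact norm_halfConv_le hri hC ht
      · rw [norm_mul]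
        gcongr
        exact norm_tailIntegral_le hmre hC ht
  · intro x hx hxb
    -- Boundedness makes the transform of `x` converge at `s = μ`, where `s^α - λ` vanishes; the
    -- remaining identity is solved for `x 0`.
    have hinit : x 0 = boundedInitialValue α lam f := by
      have h := laplace_equation_of_isCaputoSolution hα1 hfc hx hmre
        (HasLaplace.of_bounded hmre hx.1 hxb) hF
      have hpi := Real.pi_pos
      obtain ⟨h1, h2⟩ := abs_lt.1 h₀
      rw [Complex.log_exp (by linarith) (by linarith), ← hlamexp, sub_self, zero_mul] at h
      rw [hx₀, ← hlamexp]
      have := Complex.exp_ne_zero w₀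
      field_simp at h ⊢
      linear_combination -h
    intro t ht
    rcases ht.eq_or_lt with h | h
    · rw [← h, h_zero, hinit]
    -- On the line `Re s = σ` with `σ^α > ‖λ‖` the factor `s^α - λ` has no zero, so the equation can
    -- be solved for the transform.
    obtain ⟨σ, hσ, -, hσ2⟩ := exists_abscissa hα0 0 lam
    refine HasLaplace.eq_of_line (σ := σ)
      (F := fun s => ((Complex.exp (α * Complex.log s) * boundedInitialValue α lam f / s +
        ∫ t in Ioi (0 : ℝ), Complex.exp (-(s * t)) * ((f t : ℝ) : ℂ)) /
        (Complex.exp (α * Complex.log s) - lam)))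
      (fun s hs => ?_) (fun s hs => ?_) h (hx.1.continuousAt (Ici_mem_nhds h))
      ((continuousOn_variationOfConstants hα0 lam hfc _).continuousAt (Ici_mem_nhds h))
    · subst hs
      have hX := HasLaplace.of_bounded hσ hx.1 hxb
      refine hX.congr_value ?_
      rw [eq_div_iff (exp_mul_log_sub_ne_zero hα0 hσ hσ2), mul_comm, ← hinit]
      exact laplace_equation_of_isCaputoSolution hα1 hfc hx hσ hX
        (HasLaplace.of_bounded hσ hf' hfb')
    · subst hs
      exact hasLaplace_variationOfConstants hα0 hσ hσ2 (HasLaplace.of_bounded hσ hf' hfb') _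
  · intro hlim
    have hlim' : Tendsto (fun τ => ((f τ : ℝ) : ℂ)) atTop (𝓝 0) := by
      exact (Complex.continuous_ofReal.tendsto' 0 0 Complex.ofReal_zero).comp hlim
    have hR : Tendsto (solutionRemainder α lam) atTop (𝓝 0) := by
      have := (tendsto_expMixture hDc hDi).const_mul (-(lam / (2 * Real.pi * Complex.I)))
      rw [mul_zero] at this
      exact this
    have hall := ((hR.mul_const (boundedInitialValue α lam f)).add
      (tendsto_halfConv hri hf' hfb' hlim')).sub
        ((tendsto_tailIntegral hmre hf' hfb' hlim').const_mul (Complex.exp w₀ / (α * lam)))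
    simp only [zero_mul, mul_zero, add_zero, sub_zero] at hall
    refine hall.congr' ?_
    filter_upwards [eventually_gt_atTop 0] with t ht using (hrem t ht).symm
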